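/- Let $S$ be a commutative graded ring (for instance a Noetherian $\mathbb N$-graded ring with $S_0$ local), let $a\in\mathbb Z$, and let $\mathbf F: F_0\xleftarrow{d}F_1\xleftarrow{d}\cdots\xleftarrow{d}F_\ell$ be a finite complex of finitely generated graded free $S$-modules with differentials of degree $0$. Put $F=\bigoplus_n F_n(na)$, $S_i=S[t]/(t^i)$ with $\deg t=0$, and let $\operatorname{End}^\bullet(\mathbf F)$ be the endomorphism complex, $\operatorname{End}^p(\mathbf F)=\prod_n\operatorname{Hom}_S(F_n,F_{n-p})$ with differential $\varphi\mapsto d\varphi-(-1)^p\varphi d$; a subscript on its cohomology denotes the internal degree. A *free flag of degree $a$ anchored on $\mathbf F$* is a square-zero endomorphism $\partial$ of $F$, homogeneous of degree $a$, with $\partial(F_n)\subseteq\bigoplus_{m<n}F_m$ and with components $F_n\to F_{n-1}$ equal to $d$. A *deformation of $\mathbf F$ over $S_i$* ($i\ge1$) is a square-zero endomorphism $d_{i-1}=\sum_{j=1}^{i}t^{j-1}\delta_j$ of $F\otimes_S S_i$ with $\delta_1=d$ and each $\delta_j$ consisting of maps $F_n\to F_{n-j}$ of internal degree $a-ja$;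 a *lift* of it is a deformation $d_i=d_{i-1}+t^i\delta_{i+1}$ over $S_{i+1}$. 1. The free flags of degree $a$ anchored on $\mathbf F$ are exactly the endomorphisms $\partial=\sum_{j=1}^{\ell}\delta_j$ obtained by starting with $\delta_1=d$ over $S_1$, successively lifting from $S_i$ to $S_{i+1}$ for $i=1,\dots,\ell-1$, and setting $t=1$. 2. Let $i\ge 1$ and let $d_{i-1}=\sum_{j=1}^i t^{j-1}\delta_j$ be a deformation over $S_i$. The maps which on $F_n$ are $-(-1)^{ni}\sum_{j=2}^{i}\delta_j\delta_{i+2-j}$ form a cocycle of $\operatorname{End}^{i+2}(\mathbf F)$, with class in $H^{i+2}(\operatorname{End}^\bullet(\mathbf F))_{2a-(i+2)a}$, and $d_{i-1}$ has a lift over $S_{i+1}$ if and only if this class is $0$. 3. Suppose that $d_{i-1}$ has a lift, by $t^i x$ say. Assigning to a lift by $t^i y$ the class of the maps $(-1)^{ni}(y-x)|_{F_n}$ is a well-defined map from the set of lifts onto $H^{i+1}(\operatorname{End}^\bullet(\mathbf F))_{a-(i+1)a}$, and two lifts have the same class if and only if they are isomorphic as lifts, that is, there is a degree $0$ isomorphism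 of differential modules over $S_{i+1}$ between them which is the identity modulo $t^i$. Moreover, for $i\ge 1$, $[\varphi]\mapsto t^i[\varphi\otimes 1]$ is an injective $S$-linear map $H^{i+1}(\operatorname{End}_S^\bullet(\mathbf F))\to H^{i+1}(\operatorname{End}_{S_{i+1}}^\bullet(\mathbf F\otimes_S S_{i+1}))$, and for every $e\in\mathbb Z$ it maps the part of internal degree $e$ isomorphically onto $\left(\langle t^i\rangle H^{i+1}(\operatorname{End}_{S_{i+1}}^\bullet(\mathbf F\otimes_S S_{i+1}))\right)_e$. 4. Suppose that $\mathbf F$ is a graded free resolution of a graded $S$-module $M$ (for instance a finite minimal one). Then $H^p(\operatorname{End}^\bullet(\mathbf F))\cong\operatorname{Ext}^p_S(M,M)$ as $S$-modules for all $p\ge 0$. Moreover, for every graded differential module $(D,d_D)$ of degree $a$ whose homology $\ker d_D/\operatorname{im} d_D$ is isomorphic to $M$ as a graded module, there are a $\partial$ obtained from $\mathbf F$ by iterated deformation as in 1 and a degree $0$ quasi-isomorphism of differential modules $(F,\partial)\to(D,d_D)$. -/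

import Mathlib

open scoped TensorProduct Polynomial

universe u

noncomputable section

/-! ### Endomorphism complexes

A complex `⋯ → F n → F (n - 1) → ⋯` of modules over `R` is given by its total module `T = ⨁ F n`,
the family of submodules `F : ℤ → Submodule R T`, and the differential `d : T → T`, which maps
`F n` into `F (n - 1)`. An internal grading is a family `gr n k`, the part of `F n` of internal
degree `k`. -/

namespace EndComplex

variable {R T : Type u} [CommRing R] [AddCommGroup T] [Module R T]

/-- The cochains of degree `p`: families of linear maps `F n → F (n - p)`, that is, linear maps
of `⨁ F n` to itself which map `F n` into `F (n - p)` for every `n`. -/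
def cochains (F : ℤ → Submodule R T) (p : ℤ) : Submodule R (Module.End R T) where
  carrier := {φ | ∀ n, ∀ x ∈ F n, φ x ∈ F (n - p)}
  add_mem' := fun hφ hψ n x hx => (F _).add_mem (hφ n x hx) (hψ n x hx)
  zero_mem' := fun _ _ _ => (F _).zero_mem
  smul_mem' := fun c _ hφ n x hx => (F _).smul_mem c (hφ n x hx)

/-- The differential `φ ↦ d ∘ φ - (-1) ^ p • φ ∘ d` on cochains of degree `p`. -/
def diff (d : Module.End R T) (p : ℤ) : Module.End R T →ₗ[R] Module.End R T :=
  LinearMap.mulLeft R d - (p.negOnePow : ℤ) • LinearMap.mulRight R d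

/-- The cocycles of degree `p`. -/
def cocycles (F : ℤ → Submodule R T) (d : Module.End R T) (p : ℤ) :
    Submodule R (Module.End R T) :=
  cochains F p ⊓ LinearMap.ker (diff d p)

/-- The coboundaries of degree `p`. -/
def coboundaries (F : ℤ → Submodule R T) (d : Module.End R T) (p : ℤ) :
    Submodule R (Module.End R T) :=
  (cochains F (p - 1)).map (diff d (p - 1))

/-- The cohomology of the endomorphism complex in degree `p`. -/
abbrev H (F : ℤ → Submodule R T) (d : Module.End R T) (p : ℤ) : Type u :=
  cocycles F d p ⧸ (coboundaries F d p).submoduleOf (cocycles F d p)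

/-- The cohomology class of a cocycle. -/
def cls (F : ℤ → Submodule R T) (d : Module.End R T) (p : ℤ) :
    cocycles F d p →ₗ[R] H F d p :=
  Submodule.mkQ _

/-- The endomorphisms in `cochains F p` that raise the internal degree by `e`. -/
def IsHomog (gr : ℤ → ℤ → AddSubgroup T) (p e : ℤ) (φ : Module.End R T) : Prop :=
  ∀ n k, ∀ x ∈ gr n k, φ x ∈ gr (n - p) (k + e)

/-- `H^p` in internal degree `e`: the classes of the cocycles that are homogeneous of internal
degree `e`. -/
def HDeg (F : ℤ → Submodule R T) (gr : ℤ → ℤ → AddSubgroup T) (d : Module.End R T) (p e : ℤ) :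
    AddSubgroup (H F d p) where
  carrier := {c | ∃ z : cocycles F d p, IsHomog gr p e z.1 ∧ cls F d p z = c}
  add_mem' := by
    rintro _ _ ⟨z, hz, rfl⟩ ⟨w, hw, rfl⟩
    exact ⟨z + w, fun n k x hx => (gr _ _).add_mem (hz n k x hx) (hw n k x hx), map_add _ _ _⟩
  zero_mem' := ⟨0, fun _ _ _ _ => (gr _ _).zero_mem, map_zero _⟩
  neg_mem' := by
    rintro _ ⟨z, hz, rfl⟩
    exact ⟨-z, fun n k x hx => (gr _ _).neg_mem (hz n k x hx), map_neg _ _⟩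

end EndComplex

/-- The internal degree `k` part of the degree `a` fold `⨁ F n (n a)`, where
`F n (n a)` in degree `k` is `F n` in degree `k + n a`. -/
def foldGr {T : Type u} [AddCommGroup T] (gr : ℤ → ℤ → AddSubgroup T) (a k : ℤ) :
    AddSubgroup T :=
  ⨆ n : ℤ, gr n (k + n * a)

/-! ### Complexes of graded free modules -/

/-- A bounded complex `F 0 ← F 1 ← ⋯ ← F len` of finitely generated graded free modules over the
graded ring `(S, 𝒜)`, with homogeneous differential of internal degree `0`, on the total module
`T = ⨁ F n`. The part of `F n` of internal degree `k` is `gr n k`. -/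
structure GradedFreeComplex {S : Type u} [CommRing S] (𝒜 : ℤ → AddSubgroup S)
    (T : Type u) [AddCommGroup T] [Module S T] where
  /-- the module in homological degree `n` -/
  F : ℤ → Submodule S T
  /-- the part of `F n` of internal degree `k` -/
  gr : ℤ → ℤ → AddSubgroup T
  /-- the differential -/
  d : Module.End S T
  /-- the length -/
  len : ℕ
  internal : DirectSum.IsInternal F
  bounded : ∀ n : ℤ, n < 0 ∨ (len : ℤ) < n → F n = ⊥
  /-- `F n` is the graded module `⨁ S (-e i)`, with basis vectors `b i` of degree `e i` -/
  free : ∀ n, ∃ (r : ℕ) (e : Fin r → ℤ) (b : Module.Basis (Fin r) S (F n)), ∀ k x,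
    x ∈ gr n k ↔ ∃ hx : x ∈ F n, ∀ i, b.repr ⟨x, hx⟩ i ∈ 𝒜 (k - e i)
  d_mem : ∀ n, ∀ x ∈ F n, d x ∈ F (n - 1)
  d_gr : ∀ n k, ∀ x ∈ gr n k, d x ∈ gr (n - 1) k
  d_sq : d * d = 0

/-- The truncated polynomial ring `S[t] / (t ^ i)`. -/
abbrev TruncPoly (S : Type u) [CommRing S] (i : ℕ) : Type u :=
  S[X] ⧸ Ideal.span {(Polynomial.X : S[X]) ^ i}

/-- The class of `t` in `S[t] / (t ^ i)`. -/
def TruncPoly.t (S : Type u) [CommRing S] (i : ℕ) : TruncPoly S i :=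
  Ideal.Quotient.mk _ Polynomial.X

namespace GradedFreeComplex

variable {S : Type u} [CommRing S] {𝒜 : ℤ → AddSubgroup S}
  {T : Type u} [AddCommGroup T] [Module S T] (C : GradedFreeComplex 𝒜 T)

theorem bijective_coe : Function.Bijective (DirectSum.coeLinearMap C.F) := C.internal

/-- The linear map that is multiplication by `(-1) ^ n` on `F n`. -/
def parity : Module.End S T :=
  (DirectSum.toModule S ℤ T fun n => (n.negOnePow : ℤ) • (C.F n).subtype) ∘ₗ
    (LinearEquiv.ofBijective (DirectSum.coeLinearMap C.F) C.bijective_coe).symm.toLinearMap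

theorem parity_apply (n : ℤ) (x : T) (hx : x ∈ C.F n) :
    C.parity x = (n.negOnePow : ℤ) • x := by
  have h : (LinearEquiv.ofBijective (DirectSum.coeLinearMap C.F) C.bijective_coe).symm x =
      DirectSum.lof S ℤ (fun n => C.F n) n ⟨x, hx⟩ := by
    rw [LinearEquiv.symm_apply_eq, LinearEquiv.ofBijective_apply]
    exact (DirectSum.coeLinearMap_lof C.F n ⟨x, hx⟩).symm
  unfold parity
  rw [LinearMap.comp_apply, LinearEquiv.coe_coe, h, DirectSum.toModule_lof]
  rfl

/-! #### Base change to `S[t] / (t ^ i)` -/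

/-- The homological components of the complex `F ⊗ S[t] / (t ^ i)`. -/
def truncF (i : ℕ) (n : ℤ) : Submodule (TruncPoly S i) (TruncPoly S i ⊗[S] T) :=
  (C.F n).baseChange (TruncPoly S i)

/-- The internal grading on `F ⊗ S[t] / (t ^ i)`, where `t` has internal degree `0`. -/
def truncGr (i : ℕ) (n k : ℤ) : AddSubgroup (TruncPoly S i ⊗[S] T) :=
  AddSubgroup.closure {z | ∃ (m : ℕ), ∃ x ∈ C.gr n k, z = (TruncPoly.t S i ^ m) ⊗ₜ[S] x}

/-- The differential of `F ⊗ S[t] / (t ^ i)`. -/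
def truncD (i : ℕ) : Module.End (TruncPoly S i) (TruncPoly S i ⊗[S] T) :=
  C.d.baseChange (TruncPoly S i)

end GradedFreeComplex

/-- The endomorphism `∑_{j = 1}^i t ^ (j - 1) δ_j` of `T ⊗ S[t] / (t ^ i)`. -/
def stageDiff {S T : Type u} [CommRing S] [AddCommGroup T] [Module S T]
    (δ : ℕ → Module.End S T) (i : ℕ) : Module.End (TruncPoly S i) (TruncPoly S i ⊗[S] T) :=
  ∑ j ∈ Finset.Icc 1 i, TruncPoly.t S i ^ (j - 1) • (δ j).baseChange (TruncPoly S i)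

namespace GradedFreeComplex

variable {S : Type u} [CommRing S] {𝒜 : ℤ → AddSubgroup S}
  {T : Type u} [AddCommGroup T] [Module S T] (C : GradedFreeComplex 𝒜 T)

/-- The maps `δ_1 = d, δ_2, …, δ_i`, where `δ_j` consists of maps `F n → F (n - j)` of internal
degree `a - j a`, define a deformation of the degree `a` fold of the complex over
`S[t] / (t ^ i)`: the endomorphism `∑_{j = 1}^i t ^ (j - 1) δ_j` of `F ⊗ S[t] / (t ^ i)` squares
to zero. -/
structure IsDeformation (a : ℤ) (i : ℕ) (δ : ℕ → Module.End S T) : Prop where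
  one : δ 1 = C.d
  mem : ∀ j : ℕ, 1 ≤ j → j ≤ i → δ j ∈ EndComplex.cochains C.F j
  homog : ∀ j : ℕ, 1 ≤ j → j ≤ i → EndComplex.IsHomog C.gr j (a - j * a) (δ j)
  sq : stageDiff δ i * stageDiff δ i = 0

/-- Adding the term `t ^ i y` lifts the deformation `δ_1, …, δ_i` over `S[t] / (t ^ i)` to a
deformation over `S[t] / (t ^ (i + 1))`. -/
def IsLift (a : ℤ) (i : ℕ) (δ : ℕ → Module.End S T) (y : Module.End S T) : Prop :=
  C.IsDeformation a (i + 1) (Function.update δ (i + 1) y)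

/-- The differential over `S[t] / (t ^ (i + 1))` of the lift of `δ_1, …, δ_i` by `t ^ i y`. -/
def liftDiff (i : ℕ) (δ : ℕ → Module.End S T) (y : Module.End S T) :
    Module.End (TruncPoly S (i + 1)) (TruncPoly S (i + 1) ⊗[S] T) :=
  stageDiff (Function.update δ (i + 1) y) (i + 1)

/-- The lifts by `t ^ i y` and `t ^ i y'` are isomorphic as lifts: there is an isomorphism of graded
differential modules over `S[t] / (t ^ (i + 1))` between them which is the identity
modulo `t ^ i`. -/
def LiftIso (a : ℤ) (i : ℕ) (δ : ℕ → Module.End S T) (y y' : Module.End S T) : Prop :=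
  ∃ P : (TruncPoly S (i + 1) ⊗[S] T) ≃ₗ[TruncPoly S (i + 1)] (TruncPoly S (i + 1) ⊗[S] T),
    (∀ z, P (liftDiff i δ y z) = liftDiff i δ y' (P z)) ∧
    (∀ k, ∀ z ∈ foldGr (C.truncGr (i + 1)) a k, P z ∈ foldGr (C.truncGr (i + 1)) a k) ∧
    (∀ z, ∃ w, P z - z = TruncPoly.t S (i + 1) ^ i • w)

/-- The cocycle obstructing the lift of `δ_1, …, δ_i`, namely `-∑_{j = 2}^i δ_j δ_{i + 2 - j}`,
with the sign `(-1) ^ (n i)` on `F n`. (The sign turns the relation `d y + y d = ⋯` for the next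
term `y` into a relation for the differential of the endomorphism complex.) -/
def obstruction (i : ℕ) (δ : ℕ → Module.End S T) : Module.End S T :=
  -(∑ j ∈ Finset.Icc 2 i, δ j * δ (i + 2 - j)) * C.parity ^ i

/-- A free flag of degree `a` anchored on the complex: a square-zero endomorphism of `⨁ F n`, of
degree `a` for the grading of `⨁ F n (n a)`, that maps `F n` into `⨁_{m < n} F m` and whose
component `F n → F (n - 1)` is the differential of the complex. -/
structure IsAnchoredFlag (a : ℤ) (D : Module.End S T) : Prop where
  sq : D * D = 0
  homog : ∀ k, ∀ x ∈ foldGr C.gr a k, D x ∈ foldGr C.gr a (k + a)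
  lower : ∀ n, ∀ x ∈ C.F n, D x ∈ ⨆ m : {m : ℤ // m < n}, C.F m
  anchor : ∀ n, ∀ x ∈ C.F n, D x - C.d x ∈ ⨆ m : {m : ℤ // m < n - 1}, C.F m

/-- `D` is obtained from the complex by the iterated deformation with the terms `δ_1, δ_2, …`:
start with `δ_1 = d` over `S[t] / (t)`, lift from `S[t] / (t ^ i)` to `S[t] / (t ^ (i + 1))` by
adding `t ^ i δ_{i + 1}`, for `i = 1, …, len - 1`, and set `t = 1` at the end. -/
structure IsIteratedDeformation (a : ℤ) (δ : ℕ → Module.End S T) (D : Module.End S T) :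
    Prop where
  start : C.IsDeformation a 1 δ
  step : ∀ i : ℕ, 1 ≤ i → i < C.len → C.IsLift a i δ (δ (i + 1))
  specialize : D = ∑ j ∈ Finset.Icc 1 C.len, δ j

/-- The complex, with the augmentation `ε : F 0 → M`, is a graded free resolution of the graded
module `M`. -/
structure IsResolution {M : Type u} [AddCommGroup M] [Module S M] (gM : ℤ → AddSubgroup M)
    (ε : C.F 0 →ₗ[S] M) : Prop where
  graded : ∀ k, ∀ x : C.F 0, (x : T) ∈ C.gr 0 k → ε x ∈ gM k
  surjective : Function.Surjective ε
  exact_zero : ∀ x : C.F 0, ε x = 0 ↔ ∃ y ∈ C.F 1, C.d y = x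
  exact_pos : ∀ n : ℤ, 0 < n → ∀ x ∈ C.F n, C.d x = 0 → ∃ y ∈ C.F (n + 1), C.d y = x

end GradedFreeComplex

/-! ### Homology of differential modules -/

namespace DiffMod

variable {S : Type u} [CommRing S] {D D' : Type u} [AddCommGroup D] [Module S D]
  [AddCommGroup D'] [Module S D']

/-- The homology `ker d / im d` of a module with an endomorphism `d` of square zero. -/
abbrev Homology (d : Module.End S D) : Type u :=
  LinearMap.ker d ⧸ (LinearMap.range d).submoduleOf (LinearMap.ker d)

/-- The map on homology induced by a morphism of differential modules. -/
def homologyMap (d : Module.End S D) (d' : Module.End S D') (f : D →ₗ[S] D')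
    (hf : f ∘ₗ d = d' ∘ₗ f) : Homology d →ₗ[S] Homology d' :=
  Submodule.mapQ _ _
    (f.restrict (p := LinearMap.ker d) (q := LinearMap.ker d') (fun x hx => by
      have h := LinearMap.congr_fun hf x
      simp only [LinearMap.comp_apply, LinearMap.mem_ker.1 hx, map_zero] at h
      exact h.symm))
    (by
      rintro ⟨x, hx⟩ ⟨y, hy⟩
      exact ⟨f y, by
        have h := LinearMap.congr_fun hf y
        simp only [LinearMap.comp_apply] at h
        rw [← h, hy]
        rfl⟩)

end DiffMod

end

/-! Write A for the endomorphism ring of the total module T. An endomorphism of T ⊗ S[t]/(t^i) is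
determined by its values on 1 ⊗ x, so these endomorphisms form the ring A[t] modulo t^i (`evalEnd`,
`evalEnd_eq_iff`, `evalEnd_surjective`). A deformation is a polynomial P with constant term d such
that P² vanishes below t^i, and every question about deformations becomes a comparison of
coefficients.

Flags: the coefficient of t^m in P has homological degree m + 1, hence that in P² has degree m + 2.
Distinct powers of t thus carry distinct degrees, and setting t = 1 loses nothing
(`eq_zero_of_evalOne`). Maps of degree above `len` vanish, so the last truncation imposes the full
equation P² = 0.

Lifting: modulo t^(i+1), the square of P + t^i y has the single coefficient c + dy + yd at t^i,
where c is the coefficient of P². The identity P · P² = P² · P gives dc = cd. Twisting by (-1)^(ni)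
on F_n turns commutators and anticommutators with d into the differential of the endomorphism
complex (`diff_mul_parity_pow`), so lifts exist exactly when the class of the twisted -c vanishes.
Lifts differ by maps anticommuting with d. An isomorphism of lifts is 1 + t^i V, and it intertwines
the lifts by y and y' exactly when y - y' = dV - Vd. A cochain with homogeneous image under the
differential can be replaced by a homogeneous one (`exists_homog_of_diff`), so all of this respects
internal degrees. Over S[t]/(t^(i+1)) the differential acts on each coefficient separately, which
gives the comparison of cohomologies.

Resolutions: composing with the augmentation compares the endomorphism complex with Hom(F, M), which
computes Ext; the comparison rests on lifting along free modules (`exists_diff_eq`). For a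
differential module D with homology M, the flag differential E and the map f to D are built one
homological degree at a time. The next value on a basis vector b is a cycle (y, v) in the mapping
cone of f, with y equal to d b up to lower terms; it exists because the cone is acyclic in the range
already reached (`exists_cone_boundary`). The same acyclicity shows at the end that f is a
quasi-isomorphism. -/

noncomputable section

/-! ### Homogeneous components in graded abelian groups -/

section HomPart

variable {X Y : Type*} [AddCommGroup X] [AddCommGroup Y]

/-- The component of degree `k` of an element of a graded abelian group. -/
def homPart (g : ℤ → AddSubgroup X) [DirectSum.Decomposition g] (k : ℤ) : X →+ X where
  toFun x := DirectSum.decompose g x k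
  map_zero' := by simp
  map_add' x y := by simp

variable (g : ℤ → AddSubgroup X) [DirectSum.Decomposition g]
  (g' : ℤ → AddSubgroup Y) [DirectSum.Decomposition g']

theorem homPart_mem (k : ℤ) (x : X) : homPart g k x ∈ g k := SetLike.coe_mem _

theorem homPart_of_mem {k : ℤ} {x : X} (hx : x ∈ g k) : homPart g k x = x :=
  DirectSum.decompose_of_mem_same g hx

theorem homPart_of_mem_ne {j k : ℤ} {x : X} (hx : x ∈ g j) (h : j ≠ k) : homPart g k x = 0 :=
  DirectSum.decompose_of_mem_ne g hx h

theorem homogeneous_induction {p : X → Prop} (zero : p 0) (mem : ∀ k, ∀ x ∈ g k, p x)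
    (add : ∀ x y, p x → p y → p (x + y)) (x : X) : p x :=
  DirectSum.Decomposition.inductionOn g zero (fun m => mem _ _ m.2) add x

theorem homPart_map (φ : X →+ Y) (e : ℤ) (hφ : ∀ k, ∀ x ∈ g k, φ x ∈ g' (k + e)) (k : ℤ) (x : X) :
    homPart g' (k + e) (φ x) = φ (homPart g k x) := by
  induction x using homogeneous_induction g with
  | zero => simp
  | mem j x hx =>
    by_cases h : j = k
    · subst h
      rw [homPart_of_mem g hx, homPart_of_mem g' (hφ _ _ hx)]
    · rw [homPart_of_mem_ne g hx h, homPart_of_mem_ne g' (hφ _ _ hx) (by simpa using h), map_zero]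
  | add x y hx hy => simp [hx, hy]

theorem homPart_map' (φ : X →+ Y) {e k l : ℤ} (hφ : ∀ k, ∀ x ∈ g k, φ x ∈ g' (k + e))
    (hl : l = k + e) (x : X) : homPart g' l (φ x) = φ (homPart g k x) :=
  hl ▸ homPart_map g g' φ e hφ k x

end HomPart

/-! ### Bihomogeneous bases and the grading of the fold -/

namespace GradedFreeComplex

variable {S : Type u} [CommRing S] {𝒜 : ℤ → AddSubgroup S}
  {T : Type u} [AddCommGroup T] [Module S T] (C : GradedFreeComplex 𝒜 T)

/-- A basis of the total module of a complex of graded free modules consisting of elements that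
are homogeneous for the homological degree `h` and the internal degree `e`. -/
structure AdaptedBasis (ι : Type) where
  /-- the basis -/
  b : Module.Basis ι S T
  /-- the homological degrees of the basis vectors -/
  h : ι → ℤ
  /-- the internal degrees of the basis vectors -/
  e : ι → ℤ
  h_nonneg : ∀ i, 0 ≤ h i
  h_le : ∀ i, h i ≤ C.len
  mem_F : ∀ n x, x ∈ C.F n ↔ ∀ i, h i ≠ n → b.repr x i = 0
  mem_gr : ∀ n k x, x ∈ C.gr n k ↔ x ∈ C.F n ∧ ∀ i, b.repr x i ∈ 𝒜 (k - e i)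

/-- Over the zero ring a zero module has bases of every size. Replacing the basis by the empty one
outside the range 0, …, `len` keeps the homological degrees of all basis vectors bounded. -/
theorem exists_bounded_basis (n : ℤ) : ∃ (r : ℕ) (e : Fin r → ℤ)
    (b : Module.Basis (Fin r) S (C.F n)), (r ≠ 0 → 0 ≤ n ∧ n ≤ C.len) ∧ ∀ k x,
    x ∈ C.gr n k ↔ ∃ hx : x ∈ C.F n, ∀ i, b.repr ⟨x, hx⟩ i ∈ 𝒜 (k - e i) := by
  obtain ⟨r, e, b, hb⟩ := C.free n
  by_cases hn : n < 0 ∨ (C.len : ℤ) < n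
  · have hF := C.bounded n hn
    have : Subsingleton (C.F n) := by rw [hF]; infer_instance
    refine ⟨0, Fin.elim0, Module.Basis.empty _, by simp, fun k x => ⟨fun hx => ?_, ?_⟩⟩
    · obtain ⟨hx, -⟩ := (hb k x).1 hx
      exact ⟨hx, fun i => i.elim0⟩
    · rintro ⟨hx, -⟩
      refine (hb k x).2 ⟨hx, fun i => ?_⟩
      rw [Subsingleton.elim (⟨x, hx⟩ : C.F n) 0]
      simp
  · exact ⟨r, e, b, fun _ => by omega, hb⟩

theorem exists_adaptedBasis : ∃ ι : Type, Nonempty (C.AdaptedBasis ι) := by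
  choose r e b hr hb using C.exists_bounded_basis
  have hF : ∀ n x, x ∈ C.F n ↔ ∀ i : Σ n, Fin (r n), i.1 ≠ n →
      (C.internal.collectedBasis b).repr x i = 0 := by
    refine fun n x => ⟨fun hx i hi =>
      C.internal.collectedBasis_repr_of_mem_ne b (Ne.symm hi) hx, fun hx => ?_⟩
    rw [← (C.internal.collectedBasis b).linearCombination_repr x, Finsupp.linearCombination_apply]
    refine Submodule.sum_mem _ fun i hi => Submodule.smul_mem _ _ ?_
    rw [Finsupp.mem_support_iff] at hi
    have : i.1 = n := by
      by_contra h
      exact hi (hx i h)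
    subst this
    exact C.internal.collectedBasis_mem b i
  refine ⟨Σ n, Fin (r n), ⟨⟨C.internal.collectedBasis b, fun i => i.1, fun i => e i.1 i.2,
    fun i => (hr i.1 (by have := i.2.2; omega)).1, fun i => (hr i.1 (by have := i.2.2; omega)).2,
    hF, fun n k x => ?_⟩⟩⟩
  rw [hb]
  constructor
  · rintro ⟨hx, h⟩
    refine ⟨hx, fun ⟨m, i⟩ => ?_⟩
    by_cases hm : m = n
    · subst hm
      rw [C.internal.collectedBasis_repr_of_mem b hx]
      exact h i
    · rw [(hF n x).1 hx _ hm]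
      exact zero_mem _
  · rintro ⟨hx, h⟩
    refine ⟨hx, fun i => ?_⟩
    rw [← C.internal.collectedBasis_repr_of_mem b hx]
    exact h ⟨n, i⟩

namespace AdaptedBasis

variable {C} {ι : Type} (B : C.AdaptedBasis ι)

theorem basis_mem_F (i : ι) : B.b i ∈ C.F (B.h i) := by
  refine (B.mem_F _ _).2 fun j hj => ?_
  rw [Module.Basis.repr_self, Finsupp.single_eq_of_ne]
  rintro rfl
  exact hj rfl

theorem repr_of_mem_gr {n k : ℤ} {x : T} (hx : x ∈ C.gr n k) (i : ι) :
    B.b.repr x i ∈ 𝒜 (k - B.e i) := ((B.mem_gr _ _ _).1 hx).2 i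

theorem mem_iSup_F (p : ℤ → Prop) (x : T) :
    x ∈ ⨆ m : {m : ℤ // p m}, C.F m ↔ ∀ i, ¬ p (B.h i) → B.b.repr x i = 0 := by
  constructor
  · intro hx i hi
    have : (⨆ m : {m : ℤ // p m}, C.F m) ≤ LinearMap.ker (B.b.coord i) := by
      refine iSup_le fun m x hx => ?_
      exact (B.mem_F _ _).1 hx i (fun h => hi (h ▸ m.2))
    exact this hx
  · intro hx
    rw [← B.b.linearCombination_repr x, Finsupp.linearCombination_apply]
    refine Submodule.sum_mem _ fun i hi => Submodule.smul_mem _ _ ?_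
    rw [Finsupp.mem_support_iff] at hi
    have : p (B.h i) := by
      by_contra h
      exact hi (hx i h)
    exact Submodule.mem_iSup_of_mem (p := fun m : {m : ℤ // p m} => C.F m) ⟨_, this⟩
      (B.basis_mem_F i)

/-- The projection onto `F n`. -/
def pr (n : ℤ) : Module.End S T := B.b.constr S fun i => if B.h i = n then B.b i else 0

theorem repr_pr (n : ℤ) (x : T) (i : ι) :
    B.b.repr (B.pr n x) i = if B.h i = n then B.b.repr x i else 0 := by
  have : B.b.coord i ∘ₗ B.pr n = if B.h i = n then B.b.coord i else 0 := by
    refine B.b.ext fun j => ?_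
    simp only [LinearMap.comp_apply, pr, Module.Basis.constr_basis]
    by_cases hij : i = j
    · subst hij
      split_ifs <;> simp
    · split_ifs <;> simp [Finsupp.single_eq_of_ne hij]
  have := LinearMap.congr_fun this x
  rw [LinearMap.comp_apply] at this
  rw [Module.Basis.coord_apply] at this
  rw [this]
  split_ifs <;> simp

theorem pr_mem (n : ℤ) (x : T) : B.pr n x ∈ C.F n :=
  (B.mem_F _ _).2 fun i hi => by rw [repr_pr, if_neg hi]

theorem pr_of_mem {n : ℤ} {x : T} (hx : x ∈ C.F n) : B.pr n x = x := by
  refine B.b.ext_elem fun i => ?_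
  rw [repr_pr]
  split_ifs with h
  · rfl
  · exact ((B.mem_F _ _).1 hx i h).symm

theorem pr_of_mem_ne {m n : ℤ} {x : T} (hx : x ∈ C.F m) (h : m ≠ n) : B.pr n x = 0 := by
  refine B.b.ext_elem fun i => ?_
  rw [repr_pr]
  split_ifs with hi
  · rw [(B.mem_F _ _).1 hx i (by rw [hi]; exact h.symm)]
    simp
  · simp

/-- The component of degree `q` of an endomorphism: the maps `F n → F (n - q)`. -/
def comp (q : ℤ) : Module.End S T →ₗ[S] Module.End S T where
  toFun V := B.b.constr S fun i => B.pr (B.h i - q) (V (B.b i))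
  map_add' V W := B.b.ext fun i => by simp
  map_smul' c V := B.b.ext fun i => by simp

theorem induction_F {n : ℤ} {p : ∀ x : T, x ∈ C.F n → Prop} (zero : p 0 (zero_mem _))
    (add : ∀ x y hx hy, p x hx → p y hy → p (x + y) (add_mem hx hy))
    (smul : ∀ (c : S) x hx, p x hx → p (c • x) (Submodule.smul_mem _ c hx))
    (basis : ∀ i (hi : B.b i ∈ C.F n), B.h i = n → p (B.b i) hi) (x : T) (hx : x ∈ C.F n) :
    p x hx := by
  suffices ∃ h, p x h from this.2
  rw [← B.b.linearCombination_repr x, Finsupp.linearCombination_apply, Finsupp.sum]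
  refine Finset.sum_induction _ (fun x => ∃ h, p x h)
    (fun x y ⟨hx, h⟩ ⟨hy, h'⟩ => ⟨_, add x y hx hy h h'⟩) ⟨_, zero⟩ fun i hi => ?_
  have : B.h i = n := by
    by_contra h
    rw [Finsupp.mem_support_iff] at hi
    exact hi ((B.mem_F _ _).1 hx i h)
  exact ⟨_, smul _ _ _ (basis i (this ▸ B.basis_mem_F i) this)⟩

theorem comp_apply (q : ℤ) (V : Module.End S T) {n : ℤ} {x : T} (hx : x ∈ C.F n) :
    B.comp q V x = B.pr (n - q) (V x) := by
  induction x, hx using B.induction_F with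
  | zero => simp
  | add x y _ _ hx hy => simp [hx, hy]
  | smul c x _ hx => simp [hx]
  | basis i _ hi => simp [comp, hi]

theorem ext_F (B : C.AdaptedBasis ι) {N : Type*} [AddCommGroup N] [Module S N] {V W : T →ₗ[S] N}
    (h : ∀ n : ℤ, 0 ≤ n → n ≤ C.len → ∀ x ∈ C.F n, V x = W x) : V = W :=
  B.b.ext fun i => h _ (B.h_nonneg i) (B.h_le i) _ (B.basis_mem_F i)

theorem comp_mem (q : ℤ) (V : Module.End S T) : B.comp q V ∈ EndComplex.cochains C.F q :=
  fun n x hx => by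
    rw [B.comp_apply q V hx]
    exact B.pr_mem _ _

theorem comp_of_mem {q : ℤ} {V : Module.End S T} (hV : V ∈ EndComplex.cochains C.F q) :
    B.comp q V = V :=
  B.ext_F fun n _ _ x hx => by rw [B.comp_apply q V hx, B.pr_of_mem (hV n x hx)]

theorem comp_of_mem_ne {p q : ℤ} {V : Module.End S T} (hV : V ∈ EndComplex.cochains C.F p)
    (h : p ≠ q) : B.comp q V = 0 :=
  B.ext_F fun n _ _ x hx => by
    rw [B.comp_apply q V hx, B.pr_of_mem_ne (hV n x hx) (by omega), LinearMap.zero_apply]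

theorem cochains_eq_zero (B : C.AdaptedBasis ι) {q : ℤ} (hq : C.len < q) {V : Module.End S T}
    (hV : V ∈ EndComplex.cochains C.F q) : V = 0 :=
  B.ext_F fun n _ h x hx => by
    have := hV n x hx
    rw [C.bounded _ (Or.inl (by omega))] at this
    simpa using this

/-- The map `F → N` with given values on the basis vectors in one homological degree and the
values of a given map in the other degrees. -/
def update {N : Type*} [AddCommGroup N] [Module S N] (n : ℤ) (f : T →ₗ[S] N) (v : ι → N) :
    T →ₗ[S] N :=
  B.b.constr S fun i => if B.h i = n then v i else f (B.b i)

theorem update_basis {N : Type*} [AddCommGroup N] [Module S N] {n : ℤ} (f : T →ₗ[S] N)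
    (v : ι → N) {i : ι} (hi : B.h i = n) : B.update n f v (B.b i) = v i := by
  simp [update, hi]

theorem update_of_ne {N : Type*} [AddCommGroup N] [Module S N] {n : ℤ} (f : T →ₗ[S] N)
    (v : ι → N) {m : ℤ} (hm : m ≠ n) {x : T} (hx : x ∈ C.F m) : B.update n f v x = f x := by
  induction x, hx using B.induction_F with
  | zero => simp
  | add x y _ _ hx hy => simp [hx, hy]
  | smul c x _ hx => simp [hx]
  | basis i _ hi => simp [update, hi, hm]

theorem mem_foldGr (a k : ℤ) (x : T) :
    x ∈ foldGr C.gr a k ↔ ∀ i, B.b.repr x i ∈ 𝒜 (k + B.h i * a - B.e i) := by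
  constructor
  · intro hx i
    have : foldGr C.gr a k ≤ (𝒜 (k + B.h i * a - B.e i)).comap
        (B.b.coord i).toAddMonoidHom := by
      refine iSup_le fun n x hx => ?_
      rw [AddSubgroup.mem_comap]
      change B.b.repr x i ∈ _
      by_cases hi : B.h i = n
      · rw [hi]
        exact B.repr_of_mem_gr hx i
      · rw [(B.mem_F n x).1 ((B.mem_gr _ _ _).1 hx).1 i hi]
        exact zero_mem _
    exact this hx
  · intro hx
    rw [← B.b.linearCombination_repr x, Finsupp.linearCombination_apply]
    refine AddSubgroup.sum_mem _ fun i _ => ?_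
    refine AddSubgroup.mem_iSup_of_mem (B.h i) ((B.mem_gr _ _ _).2
      ⟨Submodule.smul_mem _ _ (B.basis_mem_F i), fun j => ?_⟩)
    rw [map_smul, Module.Basis.repr_self, Finsupp.smul_apply]
    by_cases hij : j = i
    · subst hij
      simpa using hx j
    · rw [Finsupp.single_eq_of_ne hij, smul_zero]
      exact zero_mem _

/-- The bigrading is recovered from the homological components and the single grading of the fold,
so component projections are needed only for the latter. For a = 0 the fold is T with its internal
grading. -/
theorem mem_gr_iff (B : C.AdaptedBasis ι) (a n k : ℤ) (x : T) :
    x ∈ C.gr n k ↔ x ∈ C.F n ∧ x ∈ foldGr C.gr a (k - n * a) := by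
  rw [B.mem_gr, B.mem_foldGr]
  refine and_congr_right fun hx => forall_congr' fun i => ?_
  by_cases hi : B.h i = n
  · rw [hi, sub_add_cancel]
  · simp [(B.mem_F n x).1 hx i hi]

section Graded

variable [GradedRing 𝒜]

theorem smul_mem_foldGr (B : C.AdaptedBasis ι) (a : ℤ) {j k : ℤ} {c : S} {x : T} (hc : c ∈ 𝒜 j)
    (hx : x ∈ foldGr C.gr a k) : c • x ∈ foldGr C.gr a (k + j) := by
  rw [B.mem_foldGr] at hx ⊢
  intro i
  rw [map_smul, Finsupp.smul_apply, smul_eq_mul]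
  convert SetLike.mul_mem_graded hc (hx i) using 2
  ring

theorem basis_mem_gr (i : ι) : B.b i ∈ C.gr (B.h i) (B.e i) := by
  refine (B.mem_gr _ _ _).2 ⟨B.basis_mem_F i, fun j => ?_⟩
  rw [Module.Basis.repr_self]
  by_cases hij : j = i
  · subst hij
    simpa using SetLike.GradedOne.one_mem
  · rw [Finsupp.single_eq_of_ne hij]
    exact zero_mem _

theorem basis_mem_foldGr (a : ℤ) (i : ι) : B.b i ∈ foldGr C.gr a (B.e i - B.h i * a) :=
  ((B.mem_gr_iff a _ _ _).1 (B.basis_mem_gr i)).2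

/-- A coordinate is a homogeneous map to S of degree `h i * a - e i`, so the coordinates of each
summand can be read off from the grading of S; this gives injectivity. For surjectivity, split every
coefficient into its homogeneous parts. -/
theorem isInternal_foldGr (B : C.AdaptedBasis ι) (a : ℤ) : DirectSum.IsInternal (foldGr C.gr a) := by
  constructor
  · rw [injective_iff_map_eq_zero]
    intro x hx
    ext k
    have key : ∀ (i : ι) (y : DirectSum ℤ fun k => foldGr C.gr a k),
        homPart 𝒜 (k + B.h i * a - B.e i)
          (B.b.repr (DirectSum.coeAddMonoidHom (foldGr C.gr a) y) i) = B.b.repr (y k) i := by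
      intro i y
      induction y using DirectSum.induction_on with
      | zero => simp
      | of j y =>
        rw [DirectSum.coeAddMonoidHom_of]
        by_cases hj : j = k
        · subst hj
          rw [DirectSum.of_eq_same]
          exact homPart_of_mem _ ((B.mem_foldGr _ _ _).1 y.2 i)
        · rw [DirectSum.of_eq_of_ne _ _ _ (Ne.symm hj),
            homPart_of_mem_ne 𝒜 ((B.mem_foldGr _ _ _).1 y.2 i) (by omega)]
          simp
      | add x y hx hy => simp [hx, hy]
    refine B.b.ext_elem fun i => ?_
    rw [← key, hx]
    simp
  · intro x
    change x ∈ (DirectSum.coeAddMonoidHom (foldGr C.gr a)).range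
    rw [← B.b.linearCombination_repr x, Finsupp.linearCombination_apply]
    refine AddSubgroup.sum_mem _ fun i _ => ?_
    generalize B.b.repr x i = c
    induction c using homogeneous_induction 𝒜 with
    | zero => simp
    | mem k c hc =>
      exact ⟨DirectSum.of (fun k => foldGr C.gr a k) _
        ⟨_, B.smul_mem_foldGr a hc (B.basis_mem_foldGr a i)⟩, DirectSum.coeAddMonoidHom_of _ _ _⟩
    | add c c' h h' =>
      simp only [add_smul]
      exact add_mem h h'

end Graded

end AdaptedBasis

/-! ### Homogeneous components of elements and of cochains -/

section Graded

variable [GradedRing 𝒜]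

instance (a : ℤ) : DirectSum.Decomposition (foldGr C.gr a) :=
  (C.exists_adaptedBasis.choose_spec.some.isInternal_foldGr a).chooseDecomposition

theorem homPart_mem_F (a k : ℤ) {n : ℤ} {x : T} (hx : x ∈ C.F n) :
    homPart (foldGr C.gr a) k x ∈ C.F n := by
  obtain ⟨ι, ⟨B⟩⟩ := C.exists_adaptedBasis
  refine (B.mem_F _ _).2 fun i hi => ?_
  have := homPart_map (foldGr C.gr a) 𝒜 (B.b.coord i).toAddMonoidHom (B.h i * a - B.e i)
    (fun k x hx => by
      rw [← add_sub_assoc]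
      exact (B.mem_foldGr _ _ _).1 hx i) k x
  change _ = B.b.repr _ i at this
  rw [← this]
  change homPart _ _ (B.b.repr x i) = 0
  rw [(B.mem_F _ _).1 hx i hi, map_zero]

theorem homPart_smul (a : ℤ) {j k : ℤ} {c : S} (hc : c ∈ 𝒜 j) (x : T) :
    homPart (foldGr C.gr a) (k + j) (c • x) = c • homPart (foldGr C.gr a) k x := by
  obtain ⟨ι, ⟨B⟩⟩ := C.exists_adaptedBasis
  exact homPart_map (foldGr C.gr a) (foldGr C.gr a) (DistribSMul.toAddMonoidHom T c) j
    (fun k x hx => B.smul_mem_foldGr a hc hx) k x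

/-- A cochain whose image under the differential is homogeneous can be replaced by a homogeneous
cochain. -/
theorem exists_homog_of_diff {p e : ℤ} {φ : Module.End S T} (hφ : φ ∈ EndComplex.cochains C.F p)
    (hd : EndComplex.IsHomog C.gr (p + 1) e (EndComplex.diff C.d p φ)) :
    ∃ ψ ∈ EndComplex.cochains C.F p, EndComplex.IsHomog C.gr p e ψ ∧
      EndComplex.diff C.d p ψ = EndComplex.diff C.d p φ := by
  obtain ⟨ι, ⟨B⟩⟩ := C.exists_adaptedBasis
  set G := foldGr C.gr 0
  -- ψ is the part of φ of internal degree e, prescribed on basis vectors. By linearity the same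
  -- formula holds on every homogeneous element, and it is compatible with the differential because
  -- d has internal degree 0.
  set ψ : Module.End S T := B.b.constr S fun i => homPart G (B.e i + e) (φ (B.b i)) with hψ
  have gr_iff : ∀ n k x, x ∈ C.gr n k ↔ x ∈ C.F n ∧ x ∈ G k := fun n k x => by
    simpa using B.mem_gr_iff 0 n k x
  have key : ∀ k, ∀ x ∈ G k, ψ x = homPart G (k + e) (φ x) := by
    intro k x hx
    rw [B.mem_foldGr] at hx
    conv_rhs => rw [← B.b.linearCombination_repr x]
    conv_lhs => rw [← B.b.linearCombination_repr x]
    rw [Finsupp.linearCombination_apply, Finsupp.sum, map_sum, map_sum, map_sum]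
    refine Finset.sum_congr rfl fun i _ => ?_
    rw [map_smul, map_smul, hψ, Module.Basis.constr_basis, ← C.homPart_smul 0 (hx i)]
    congr 2
    ring
  have hψF : ψ ∈ EndComplex.cochains C.F p := fun n x hx => by
    induction x, hx using B.induction_F with
    | zero => simp
    | add x y _ _ hx hy => simpa using add_mem hx hy
    | smul c x _ hx => simpa using Submodule.smul_mem _ _ hx
    | basis i _ hi =>
      rw [hψ, Module.Basis.constr_basis]
      exact C.homPart_mem_F _ _ (hφ _ _ (hi ▸ B.basis_mem_F i))
  have hψG : EndComplex.IsHomog C.gr p e ψ := fun n k x hx => by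
    rw [gr_iff] at hx ⊢
    refine ⟨hψF _ _ hx.1, ?_⟩
    rw [key _ _ hx.2]
    exact homPart_mem _ _ _
  refine ⟨ψ, hψF, hψG, B.b.ext fun i => ?_⟩
  have hi := B.basis_mem_gr i
  have hdi := C.d_gr _ _ _ hi
  have hdG : ∀ k, ∀ x ∈ G k, C.d x ∈ G (k + 0) := by
    intro k x hx
    rw [add_zero]
    simp only [G, foldGr, mul_zero, add_zero] at hx ⊢
    induction hx using AddSubgroup.iSup_induction' with
    | hp n x hx => exact AddSubgroup.mem_iSup_of_mem _ (C.d_gr _ _ _ hx)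
    | h1 => simp
    | hadd x y _ _ hx hy => simpa using add_mem hx hy
  have hφi := hd _ _ _ hi
  have e1 : homPart G (B.e i + e) (C.d (φ (B.b i))) = C.d (ψ (B.b i)) := by
    rw [key _ _ ((gr_iff _ _ _).1 hi).2]
    exact homPart_map' G G C.d.toAddMonoidHom hdG (by ring) _
  have e2 : ψ (C.d (B.b i)) = homPart G (B.e i + e) (φ (C.d (B.b i))) :=
    key _ _ ((gr_iff _ _ _).1 hdi).2
  have e3 := homPart_of_mem G ((gr_iff _ _ _).1 hφi).2
  rw [← e3]
  simp only [EndComplex.diff, LinearMap.sub_apply, LinearMap.smul_apply, LinearMap.mulLeft_apply,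
    LinearMap.mulRight_apply, Module.End.mul_apply, map_sub, map_zsmul, e1, e2]

end Graded

end GradedFreeComplex

/-! ### Endomorphisms over S[t]/(t^i) as truncated polynomials -/

section TruncPoly

variable {S : Type u} [CommRing S] {T : Type u} [AddCommGroup T] [Module S T]

namespace TruncPoly

/-- The coefficient of `t ^ m`, for `m < i`. -/
def coeff (S : Type u) [CommRing S] (i m : ℕ) : TruncPoly S i →ₗ[S] S :=
  Submodule.liftQ ((Ideal.span {(Polynomial.X : S[X]) ^ i}).restrictScalars S)
      -- For m ≥ i the coefficient does not descend to the quotient, and 0 is a default value.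
      (if m < i then Polynomial.lcoeff S m else 0) (by
        intro p hp
        rw [Submodule.restrictScalars_mem, Ideal.mem_span_singleton] at hp
        rw [LinearMap.mem_ker]
        split_ifs with h
        · exact Polynomial.X_pow_dvd_iff.1 hp m h
        · rfl) ∘ₗ
    (Submodule.Quotient.restrictScalarsEquiv S
      (Ideal.span {(Polynomial.X : S[X]) ^ i})).symm.toLinearMap

theorem coeff_mk (i m : ℕ) (p : S[X]) :
    coeff S i m (Ideal.Quotient.mk _ p) = if m < i then p.coeff m else 0 := by
  change (if m < i then Polynomial.lcoeff S m else 0) p = _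
  split_ifs <;> rfl

theorem t_pow (i m : ℕ) : t S i ^ m = Ideal.Quotient.mk _ (Polynomial.X ^ m) := (map_pow _ _ _).symm

theorem coeff_t_pow (i m k : ℕ) : coeff S i m (t S i ^ k) = if m < i ∧ m = k then 1 else 0 := by
  rw [t_pow, coeff_mk, Polynomial.coeff_X_pow, ite_and]

theorem t_pow_eq_zero {i m : ℕ} (h : i ≤ m) : t S i ^ m = 0 := by
  rw [t_pow, Ideal.Quotient.eq_zero_iff_mem, Ideal.mem_span_singleton]
  exact pow_dvd_pow _ h

theorem sum_coeff (i : ℕ) (c : TruncPoly S i) :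
    ∑ m ∈ Finset.range i, coeff S i m c • t S i ^ m = c := by
  obtain ⟨p, rfl⟩ := Ideal.Quotient.mk_surjective c
  induction p using Polynomial.induction_on' with
  | add p q hp hq => simp only [map_add, add_smul, Finset.sum_add_distrib, hp, hq]
  | monomial k s =>
    have h : (Ideal.Quotient.mk (Ideal.span {(Polynomial.X : S[X]) ^ i}))
        (Polynomial.monomial k s) = s • t S i ^ k := by
      rw [t_pow, ← Polynomial.smul_X_eq_monomial]
      rfl
    simp_rw [h, map_smul, coeff_t_pow]
    by_cases hk : k < i
    · rw [Finset.sum_eq_single k]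
      · simp [hk]
      · intro m _ hm
        simp [hm]
      · simp [hk]
    · rw [t_pow_eq_zero (not_lt.1 hk), smul_zero]
      refine Finset.sum_eq_zero fun m hm => ?_
      rw [if_neg, smul_zero, zero_smul]
      rintro ⟨h', rfl⟩
      exact hk h'

/-- The coefficient of `t ^ m` of an element of `T ⊗ S[t] / (t ^ i)`, for `m < i`. -/
def tensorCoeff (S T : Type u) [CommRing S] [AddCommGroup T] [Module S T] (i m : ℕ) :
    TruncPoly S i ⊗[S] T →ₗ[S] T :=
  (TensorProduct.lid S T).toLinearMap ∘ₗ (coeff S i m).rTensor T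

@[simp]
theorem tensorCoeff_tmul (i m : ℕ) (c : TruncPoly S i) (x : T) :
    tensorCoeff S T i m (c ⊗ₜ x) = coeff S i m c • x := by
  simp [tensorCoeff]

theorem sum_tensorCoeff (i : ℕ) (z : TruncPoly S i ⊗[S] T) :
    ∑ m ∈ Finset.range i, (t S i ^ m) ⊗ₜ[S] tensorCoeff S T i m z = z := by
  induction z with
  | zero => simp
  | add z w hz hw => simp only [map_add, TensorProduct.tmul_add, Finset.sum_add_distrib, hz, hw]
  | tmul c x =>
    conv_rhs => rw [← sum_coeff i c]
    simp [TensorProduct.sum_tmul, TensorProduct.smul_tmul]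

theorem ext_tensorCoeff {i : ℕ} {z w : TruncPoly S i ⊗[S] T}
    (h : ∀ m < i, tensorCoeff S T i m z = tensorCoeff S T i m w) : z = w := by
  rw [← sum_tensorCoeff i z, ← sum_tensorCoeff i w]
  exact Finset.sum_congr rfl fun m hm => by rw [h m (Finset.mem_range.1 hm)]

theorem tensorCoeff_t_pow_smul_of_lt {i m k : ℕ} (h : m < k) (z : TruncPoly S i ⊗[S] T) :
    tensorCoeff S T i m (t S i ^ k • z) = 0 := by
  conv_lhs => rw [← sum_tensorCoeff i z]
  rw [Finset.smul_sum, map_sum]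
  refine Finset.sum_eq_zero fun l _ => ?_
  rw [TensorProduct.smul_tmul', smul_eq_mul, ← pow_add, tensorCoeff_tmul, coeff_t_pow,
    if_neg (by omega), zero_smul]

theorem end_ext {i : ℕ} {N : Type*} [AddCommGroup N] [Module (TruncPoly S i) N]
    {φ ψ : TruncPoly S i ⊗[S] T →ₗ[TruncPoly S i] N}
    (h : ∀ x : T, φ (1 ⊗ₜ x) = ψ (1 ⊗ₜ x)) : φ = ψ := by
  refine LinearMap.ext fun z => ?_
  induction z with
  | zero => simp
  | add z w hz hw => rw [map_add, map_add, hz, hw]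
  | tmul c x =>
    have : c ⊗ₜ[S] x = c • ((1 : TruncPoly S i) ⊗ₜ[S] x) := by
      rw [TensorProduct.smul_tmul', smul_eq_mul, mul_one]
    rw [this, map_smul, map_smul, h]

/-- Evaluation at `t` of polynomials over the endomorphism ring of `T`. -/
def evalEnd (S T : Type u) [CommRing S] [AddCommGroup T] [Module S T] (i : ℕ) :
    (Module.End S T)[X] →+* Module.End (TruncPoly S i) (TruncPoly S i ⊗[S] T) :=
  Polynomial.eval₂RingHom' (Module.End.baseChangeHom S (TruncPoly S i) T).toRingHom
    (algebraMap (TruncPoly S i) _ (t S i)) fun _ => (Algebra.commutes _ _).symm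

theorem evalEnd_monomial (i m : ℕ) (φ : Module.End S T) :
    evalEnd S T i (Polynomial.monomial m φ) = t S i ^ m • φ.baseChange (TruncPoly S i) := by
  change Polynomial.eval₂ _ _ _ = _
  rw [Polynomial.eval₂_monomial, ← map_pow, ← Algebra.commutes, ← Algebra.smul_def]
  rfl

theorem evalEnd_C (i : ℕ) (φ : Module.End S T) :
    evalEnd S T i (Polynomial.C φ) = φ.baseChange (TruncPoly S i) := by
  rw [← Polynomial.monomial_zero_left, evalEnd_monomial, pow_zero]
  exact one_smul (TruncPoly S i) (φ.baseChange (TruncPoly S i))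

theorem tensorCoeff_evalEnd {i m : ℕ} (hm : m < i) (p : (Module.End S T)[X]) (x : T) :
    tensorCoeff S T i m (evalEnd S T i p (1 ⊗ₜ x)) = p.coeff m x := by
  induction p using Polynomial.induction_on' with
  | add p q hp hq => simp [hp, hq]
  | monomial k φ =>
    rw [evalEnd_monomial, LinearMap.smul_apply, LinearMap.baseChange_tmul,
      TensorProduct.smul_tmul', smul_eq_mul, mul_one, tensorCoeff_tmul, coeff_t_pow,
      Polynomial.coeff_monomial]
    by_cases h : k = m
    · subst h
      simp [hm]
    · simp [h, Ne.symm h]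

/-- Endomorphisms over S[t]/(t^i) are determined by the t-coefficients of their values on 1 ⊗ x.
Equations between them thus become equations between coefficients below t^i. -/
theorem evalEnd_eq_iff {i : ℕ} {p q : (Module.End S T)[X]} :
    evalEnd S T i p = evalEnd S T i q ↔ ∀ m < i, p.coeff m = q.coeff m := by
  constructor
  · intro h m hm
    ext x
    rw [← tensorCoeff_evalEnd hm, h, tensorCoeff_evalEnd hm]
  · intro h
    refine end_ext fun x => ext_tensorCoeff fun m hm => ?_
    rw [tensorCoeff_evalEnd hm, tensorCoeff_evalEnd hm, h m hm]

/-- The coefficient of t^m in a preimage of Φ sends x to the t^m-coefficient of Φ(1 ⊗ x). -/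
theorem evalEnd_surjective (i : ℕ) : Function.Surjective (evalEnd S T i) := by
  intro Φ
  refine ⟨∑ m ∈ Finset.range i, Polynomial.monomial m
    (tensorCoeff S T i m ∘ₗ Φ.restrictScalars S ∘ₗ TensorProduct.mk S _ T 1), ?_⟩
  refine end_ext fun x => ext_tensorCoeff fun m hm => ?_
  rw [tensorCoeff_evalEnd hm, Polynomial.finsetSum_coeff, Finset.sum_eq_single m]
  · rw [Polynomial.coeff_monomial_same]
    rfl
  · intro k _ hk
    exact Polynomial.coeff_monomial_of_ne _ hk.symm
  · intro h
    exact absurd (Finset.mem_range.2 hm) h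

theorem evalEnd_t_pow_smul (i k : ℕ) (p : (Module.End S T)[X]) :
    t S i ^ k • evalEnd S T i p = evalEnd S T i (Polynomial.X ^ k * p) := by
  have h : evalEnd S T i (Polynomial.X ^ k) = t S i ^ k • 1 := by
    have := evalEnd_monomial i k (1 : Module.End S T)
    rwa [show (1 : Module.End S T).baseChange (TruncPoly S i) = 1 from LinearMap.baseChange_id,
      Polynomial.monomial_one_right_eq_X_pow] at this
  rw [map_mul, h, smul_one_mul]

end TruncPoly

open TruncPoly in
theorem stageDiff_eq_evalEnd {δ : ℕ → Module.End S T} {i : ℕ} {p : (Module.End S T)[X]}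
    (hp : ∀ m < i, p.coeff m = δ (m + 1)) : stageDiff δ i = evalEnd S T i p := by
  have h : stageDiff δ i =
      evalEnd S T i (∑ j ∈ Finset.Icc 1 i, Polynomial.monomial (j - 1) (δ j)) := by
    simp only [stageDiff, map_sum, evalEnd_monomial]
  rw [h, evalEnd_eq_iff]
  intro m hm
  rw [Polynomial.finsetSum_coeff, hp m hm, Finset.sum_eq_single (m + 1)]
  · simp
  · intro j hj hne
    rw [Finset.mem_Icc] at hj
    exact Polynomial.coeff_monomial_of_ne _ (by omega)
  · intro h
    exact absurd (Finset.mem_Icc.2 ⟨by omega, hm⟩) h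

open TruncPoly in
-- The polynomial is prescribed only below t^i, so one polynomial serves for a deformation and for
-- all its truncations.
theorem stageDiff_sq_eq_zero_iff {δ : ℕ → Module.End S T} {i : ℕ} {p : (Module.End S T)[X]}
    (hp : ∀ m < i, p.coeff m = δ (m + 1)) :
    stageDiff δ i * stageDiff δ i = 0 ↔ ∀ m < i, (p * p).coeff m = 0 := by
  rw [stageDiff_eq_evalEnd hp, ← map_mul, ← map_zero (evalEnd S T i), evalEnd_eq_iff]
  simp

/-- The polynomial `∑_{j = 1}^i t ^ (j - 1) δ_j`. -/
def stagePoly (δ : ℕ → Module.End S T) (i : ℕ) : (Module.End S T)[X] :=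
  ∑ m ∈ Finset.range i, Polynomial.monomial m (δ (m + 1))

theorem coeff_stagePoly (δ : ℕ → Module.End S T) (i m : ℕ) :
    (stagePoly δ i).coeff m = if m < i then δ (m + 1) else 0 := by
  rw [stagePoly, Polynomial.finsetSum_coeff]
  split_ifs with h
  · rw [Finset.sum_eq_single m]
    · simp
    · intro j _ hne
      exact Polynomial.coeff_monomial_of_ne _ hne.symm
    · intro h'
      exact absurd (Finset.mem_range.2 h) h'
  · refine Finset.sum_eq_zero fun j hj => Polynomial.coeff_monomial_of_ne _ ?_
    rw [Finset.mem_range] at hj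
    omega

end TruncPoly

/-! ### Cochains, differential and internal degree of the base-changed complex -/

namespace GradedFreeComplex

open TruncPoly

variable {S : Type u} [CommRing S] {𝒜 : ℤ → AddSubgroup S}
  {T : Type u} [AddCommGroup T] [Module S T] (C : GradedFreeComplex 𝒜 T)

theorem mem_truncF_iff {i : ℕ} {n : ℤ} {z : TruncPoly S i ⊗[S] T} :
    z ∈ C.truncF i n ↔ ∀ m < i, tensorCoeff S T i m z ∈ C.F n := by
  constructor
  · intro hz m _
    rw [truncF, Submodule.baseChange_eq_span] at hz
    induction hz using Submodule.span_induction generalizing m with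
    | mem z hz =>
      obtain ⟨x, hx, rfl⟩ := hz
      simpa using Submodule.smul_mem _ _ hx
    | zero => simp
    | add z w _ _ hz hw =>
      rw [map_add]
      exact add_mem (hz m ‹_›) (hw m ‹_›)
    | smul c z _ hz =>
      rw [← sum_tensorCoeff i z, ← sum_coeff i c, Finset.smul_sum, map_sum]
      refine Submodule.sum_mem _ fun k hk => ?_
      rw [TensorProduct.smul_tmul', tensorCoeff_tmul]
      exact Submodule.smul_mem _ _ (hz k (Finset.mem_range.1 hk))
  · intro h
    rw [← sum_tensorCoeff i z]
    refine Submodule.sum_mem _ fun m hm => ?_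
    exact Submodule.tmul_mem_baseChange_of_mem _ (h m (Finset.mem_range.1 hm))

theorem one_tmul_mem_truncF (i : ℕ) {n : ℤ} {x : T} (hx : x ∈ C.F n) :
    (1 : TruncPoly S i) ⊗ₜ[S] x ∈ C.truncF i n :=
  Submodule.tmul_mem_baseChange_of_mem _ hx

theorem evalEnd_mem_cochains_iff {i : ℕ} {q : ℤ} {p : (Module.End S T)[X]} :
    evalEnd S T i p ∈ EndComplex.cochains (C.truncF i) q ↔
      ∀ m < i, p.coeff m ∈ EndComplex.cochains C.F q := by
  constructor
  · intro h m hm n x hx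
    rw [← tensorCoeff_evalEnd hm]
    exact (C.mem_truncF_iff).1 (h n _ (C.one_tmul_mem_truncF i hx)) m hm
  · intro h n z hz
    rw [truncF, Submodule.baseChange_eq_span] at hz
    induction hz using Submodule.span_induction with
    | mem z hz =>
      obtain ⟨x, hx, rfl⟩ := hz
      refine (C.mem_truncF_iff).2 fun m hm => ?_
      rw [TensorProduct.mk_apply, tensorCoeff_evalEnd hm]
      exact h m hm n x hx
    | zero => simp
    | add z w _ _ hz hw =>
      rw [map_add]
      exact add_mem hz hw
    | smul c z _ hz =>
      rw [map_smul]
      exact Submodule.smul_mem _ _ hz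

/-- The differential of the base-changed complex is the constant polynomial d; hence, with
`coeff_diff`, the differential of its endomorphism complex acts on each coefficient separately. -/
theorem diff_evalEnd (i : ℕ) (q : ℤ) (p : (Module.End S T)[X]) :
    EndComplex.diff (C.truncD i) q (evalEnd S T i p) = evalEnd S T i
      (Polynomial.C C.d * p - (q.negOnePow : ℤ) • (p * Polynomial.C C.d)) := by
  rw [map_sub, map_zsmul, map_mul, map_mul, evalEnd_C]
  rfl

theorem coeff_diff (q : ℤ) (p : (Module.End S T)[X]) (m : ℕ) :
    (Polynomial.C C.d * p - (q.negOnePow : ℤ) • (p * Polynomial.C C.d)).coeff m =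
      EndComplex.diff C.d q (p.coeff m) := by
  rw [Polynomial.coeff_sub, Polynomial.coeff_smul, Polynomial.coeff_C_mul, Polynomial.coeff_mul_C]
  rfl

theorem mem_truncGr {i : ℕ} {n k : ℤ} {z : TruncPoly S i ⊗[S] T} (hz : z ∈ C.truncGr i n k)
    (m : ℕ) : tensorCoeff S T i m z ∈ C.gr n k := by
  have : C.truncGr i n k ≤ (C.gr n k).comap (tensorCoeff S T i m).toAddMonoidHom := by
    refine (AddSubgroup.closure_le _).2 ?_
    rintro _ ⟨l, x, hx, rfl⟩
    change tensorCoeff S T i m ((t S i ^ l) ⊗ₜ[S] x) ∈ C.gr n k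
    rw [tensorCoeff_tmul, coeff_t_pow]
    split_ifs
    · rwa [one_smul]
    · rw [zero_smul]
      exact zero_mem _
  exact this hz

theorem t_pow_tmul_mem_truncGr (i m : ℕ) {n k : ℤ} {x : T} (hx : x ∈ C.gr n k) :
    (t S i ^ m) ⊗ₜ[S] x ∈ C.truncGr i n k :=
  AddSubgroup.subset_closure ⟨m, x, hx, rfl⟩

theorem t_pow_smul_mem_truncGr (i m : ℕ) {n k : ℤ} {z : TruncPoly S i ⊗[S] T}
    (hz : z ∈ C.truncGr i n k) : t S i ^ m • z ∈ C.truncGr i n k := by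
  have : C.truncGr i n k ≤ (C.truncGr i n k).comap
      (DistribSMul.toAddMonoidHom (TruncPoly S i ⊗[S] T) (t S i ^ m)) := by
    refine (AddSubgroup.closure_le _).2 ?_
    rintro _ ⟨l, x, hx, rfl⟩
    change t S i ^ m • ((t S i ^ l) ⊗ₜ[S] x) ∈ C.truncGr i n k
    rw [TensorProduct.smul_tmul', smul_eq_mul, ← pow_add]
    exact C.t_pow_tmul_mem_truncGr i _ hx
  exact this hz

theorem isHomog_baseChange {q e : ℤ} {φ : Module.End S T} (hφ : EndComplex.IsHomog C.gr q e φ)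
    (i : ℕ) : EndComplex.IsHomog (C.truncGr i) q e (φ.baseChange (TruncPoly S i)) := by
  intro n k z hz
  have : C.truncGr i n k ≤ (C.truncGr i (n - q) (k + e)).comap
      (φ.baseChange (TruncPoly S i)).toAddMonoidHom := by
    refine (AddSubgroup.closure_le _).2 ?_
    rintro _ ⟨l, x, hx, rfl⟩
    exact C.t_pow_tmul_mem_truncGr i l (hφ _ _ _ hx)
  exact this hz

theorem isHomog_of_evalEnd {i : ℕ} {q e : ℤ} {p : (Module.End S T)[X]}
    (hp : EndComplex.IsHomog (C.truncGr i) q e (evalEnd S T i p)) {m : ℕ} (hm : m < i) :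
    EndComplex.IsHomog C.gr q e (p.coeff m) := by
  intro n k x hx
  rw [← tensorCoeff_evalEnd hm]
  refine C.mem_truncGr (hp n k _ ?_) m
  simpa using C.t_pow_tmul_mem_truncGr i 0 hx

end GradedFreeComplex

/-! ### Products, homogeneity and classes in endomorphism complexes -/

namespace EndComplex

section

variable {R T : Type u} [CommRing R] [AddCommGroup T] [Module R T]

theorem mul_mem_cochains {F : ℤ → Submodule R T} {p q : ℤ} {φ ψ : Module.End R T}
    (hφ : φ ∈ cochains F p) (hψ : ψ ∈ cochains F q) : φ * ψ ∈ cochains F (p + q) := by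
  intro n x hx
  have := hφ _ _ (hψ _ _ hx)
  rwa [sub_sub, add_comm q p] at this

theorem IsHomog.mul {gr : ℤ → ℤ → AddSubgroup T} {p q e f : ℤ} {φ ψ : Module.End R T}
    (hφ : IsHomog gr p e φ) (hψ : IsHomog gr q f ψ) : IsHomog gr (p + q) (e + f) (φ * ψ) := by
  intro n k x hx
  have := hφ _ _ _ (hψ _ _ _ hx)
  rwa [sub_sub, add_comm q p, add_assoc, add_comm f e] at this

theorem IsHomog.neg {gr : ℤ → ℤ → AddSubgroup T} {p e : ℤ} {φ : Module.End R T}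
    (hφ : IsHomog gr p e φ) : IsHomog gr p e (-φ) := fun n k x hx => neg_mem (hφ n k x hx)

theorem IsHomog.add {gr : ℤ → ℤ → AddSubgroup T} {p e : ℤ} {φ ψ : Module.End R T}
    (hφ : IsHomog gr p e φ) (hψ : IsHomog gr p e ψ) : IsHomog gr p e (φ + ψ) :=
  fun n k x hx => add_mem (hφ n k x hx) (hψ n k x hx)

theorem IsHomog.sub {gr : ℤ → ℤ → AddSubgroup T} {p e : ℤ} {φ ψ : Module.End R T}
    (hφ : IsHomog gr p e φ) (hψ : IsHomog gr p e ψ) : IsHomog gr p e (φ - ψ) :=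
  fun n k x hx => sub_mem (hφ n k x hx) (hψ n k x hx)

theorem IsHomog.sum {α : Type*} {gr : ℤ → ℤ → AddSubgroup T} {p e : ℤ} (s : Finset α)
    {φ : α → Module.End R T} (hφ : ∀ j ∈ s, IsHomog gr p e (φ j)) :
    IsHomog gr p e (∑ j ∈ s, φ j) := fun n k x hx => by
  rw [LinearMap.sum_apply]
  exact sum_mem fun j hj => hφ j hj n k x hx

theorem diff_apply (d : Module.End R T) (p : ℤ) (φ : Module.End R T) :
    diff d p φ = d * φ - (p.negOnePow : ℤ) • (φ * d) := rfl

theorem mem_cocycles {F : ℤ → Submodule R T} {d : Module.End R T} {p : ℤ} {φ : Module.End R T} :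
    φ ∈ cocycles F d p ↔ φ ∈ cochains F p ∧ diff d p φ = 0 := Iff.rfl

theorem mem_coboundaries {F : ℤ → Submodule R T} {d : Module.End R T} {p q : ℤ} (h : p = q + 1)
    {φ : Module.End R T} : φ ∈ coboundaries F d p ↔ ∃ ψ ∈ cochains F q, diff d q ψ = φ := by
  obtain rfl : q = p - 1 := by omega
  exact Iff.rfl

theorem cls_eq_zero_iff {F : ℤ → Submodule R T} {d : Module.End R T} {p : ℤ}
    {z : cocycles F d p} : cls F d p z = 0 ↔ z.1 ∈ coboundaries F d p := by
  rw [cls, Submodule.mkQ_apply, Submodule.Quotient.mk_eq_zero]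
  exact Iff.rfl

theorem cls_eq_iff {F : ℤ → Submodule R T} {d : Module.End R T} {p : ℤ}
    {z w : cocycles F d p} : cls F d p z = cls F d p w ↔ z.1 - w.1 ∈ coboundaries F d p := by
  rw [← sub_eq_zero, ← map_sub, cls_eq_zero_iff]
  rfl

theorem cls_surjective (F : ℤ → Submodule R T) (d : Module.End R T) (p : ℤ) :
    Function.Surjective (cls F d p) := Submodule.mkQ_surjective _

end

end EndComplex

/-! ### Lowest-order coefficients and evaluation at 1 -/

section PolynomialCoeff

variable {A : Type*} [Ring A]

/-- A factor that starts at t^i meets only the constant term of the other factor, up to and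
including t^i. This computes the cross terms with t^i y and the first coefficient of P · P². -/
theorem coeff_mul_of_coeff_right_eq_zero {p q : A[X]} {i : ℕ} (hq : ∀ m < i, q.coeff m = 0) {m : ℕ}
    (hm : m ≤ i) : (p * q).coeff m = p.coeff 0 * q.coeff m := by
  rw [Polynomial.coeff_mul, Finset.sum_eq_single (0, m)]
  · rintro ⟨j, k⟩ hjk hne
    rw [Finset.HasAntidiagonal.mem_antidiagonal] at hjk
    rw [hq k, mul_zero]
    by_contra h
    exact hne (by ext <;> simp <;> omega)
  · simp

theorem coeff_mul_of_coeff_left_eq_zero {p q : A[X]} {i : ℕ} (hp : ∀ m < i, p.coeff m = 0) {m : ℕ}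
    (hm : m ≤ i) : (p * q).coeff m = p.coeff m * q.coeff 0 := by
  rw [Polynomial.coeff_mul, Finset.sum_eq_single (m, 0)]
  · rintro ⟨j, k⟩ hjk hne
    rw [Finset.HasAntidiagonal.mem_antidiagonal] at hjk
    rw [hp j, zero_mul]
    by_contra h
    exact hne (by ext <;> simp <;> omega)
  · simp

theorem coeff_monomial_of_lt {i : ℕ} (y : A) : ∀ m < i, (Polynomial.monomial i y).coeff m = 0 :=
  fun _ hm => Polynomial.coeff_monomial_of_ne _ hm.ne

/-- The value of a polynomial at `1`. -/
def evalOne (A : Type*) [Ring A] : A[X] →+* A :=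
  Polynomial.eval₂RingHom' (RingHom.id A) 1 fun _ => Commute.one_right _

theorem evalOne_apply (p : A[X]) : evalOne A p = p.sum fun _ a => a := by
  change Polynomial.eval₂ _ _ p = _
  simp [Polynomial.eval₂_eq_sum]

theorem evalOne_monomial (m : ℕ) (a : A) : evalOne A (Polynomial.monomial m a) = a := by
  change Polynomial.eval₂ _ _ _ = _
  simp

end PolynomialCoeff

section StagePoly

variable {S : Type u} [CommRing S] {T : Type u} [AddCommGroup T] [Module S T]

theorem evalOne_stagePoly (δ : ℕ → Module.End S T) (i : ℕ) :
    evalOne _ (stagePoly δ i) = ∑ m ∈ Finset.range i, δ (m + 1) := by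
  simp [stagePoly, evalOne_monomial]

theorem stagePoly_update (δ : ℕ → Module.End S T) (i : ℕ) (y : Module.End S T) :
    stagePoly (Function.update δ (i + 1) y) (i + 1) =
      stagePoly δ i + Polynomial.monomial i y := by
  rw [stagePoly, stagePoly, Finset.sum_range_succ, Function.update_self]
  congr 1
  refine Finset.sum_congr rfl fun m hm => ?_
  rw [Finset.mem_range] at hm
  rw [Function.update_of_ne (by omega)]

theorem coeff_stagePoly_of_lt {δ : ℕ → Module.End S T} {i m : ℕ} (h : m < i) :
    (stagePoly δ i).coeff m = δ (m + 1) := by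
  rw [coeff_stagePoly, if_pos h]

/-- The truncated polynomial has no t^i-coefficient, so the products indexed by k = 0 and k = i drop
out, and j = k + 1 runs from 2 to i. -/
theorem coeff_stagePoly_mul_self (δ : ℕ → Module.End S T) (i : ℕ) :
    (stagePoly δ i * stagePoly δ i).coeff i = ∑ j ∈ Finset.Icc 2 i, δ j * δ (i + 2 - j) := by
  rw [Polynomial.coeff_mul, Finset.Nat.sum_antidiagonal_eq_sum_range_succ_mk]
  rw [← Finset.sum_subset (s₁ := Finset.Ico 1 i)]
  · refine Finset.sum_nbij (· + 1) ?_ ?_ ?_ ?_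
    · intro k hk
      simp only [Finset.mem_Ico, Finset.mem_Icc] at hk ⊢
      omega
    · intro k _ l _ h
      simpa using h
    · intro k hk
      simp only [Finset.coe_Icc, Set.mem_Icc, Finset.coe_Ico, Set.mem_image, Set.mem_Ico] at hk ⊢
      exact ⟨k - 1, by omega, by omega⟩
    · intro k hk
      rw [Finset.mem_Ico] at hk
      rw [coeff_stagePoly_of_lt hk.2, coeff_stagePoly_of_lt (by omega)]
      congr 2
      omega
  · intro k hk
    simp only [Finset.mem_Ico, Finset.mem_range] at hk ⊢
    omega
  · intro k hk hk'
    simp only [Finset.mem_Ico, Finset.mem_range] at hk hk'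
    rw [coeff_stagePoly, coeff_stagePoly]
    split_ifs
    · omega
    all_goals simp

end StagePoly

/-! ### The sign twist (-1)^(ni), flags and obstructions -/

namespace GradedFreeComplex

open EndComplex

variable {S : Type u} [CommRing S] {𝒜 : ℤ → AddSubgroup S}
  {T : Type u} [AddCommGroup T] [Module S T] (C : GradedFreeComplex 𝒜 T)

theorem mem_F_of_mem_gr {n k : ℤ} {x : T} (hx : x ∈ C.gr n k) : x ∈ C.F n := by
  obtain ⟨ι, ⟨B⟩⟩ := C.exists_adaptedBasis
  exact ((B.mem_gr _ _ _).1 hx).1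

theorem d_mem_cochains : C.d ∈ cochains C.F 1 := C.d_mem

theorem parity_mem_cochains : C.parity ∈ cochains C.F 0 := fun n x hx => by
  rw [C.parity_apply n x hx, sub_zero]
  exact zsmul_mem hx _

theorem isHomog_parity : IsHomog C.gr 0 0 C.parity := fun n k x hx => by
  rw [C.parity_apply n x (C.mem_F_of_mem_gr hx), sub_zero, add_zero]
  exact zsmul_mem hx _

theorem parity_mul_self : C.parity * C.parity = 1 := by
  obtain ⟨ι, ⟨B⟩⟩ := C.exists_adaptedBasis
  refine B.ext_F fun n _ _ x hx => ?_
  rw [Module.End.mul_apply, C.parity_apply n x hx, map_zsmul, C.parity_apply n x hx, smul_smul,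
    ← Units.val_mul, ← Int.negOnePow_add, ← two_mul, Int.negOnePow_two_mul]
  simp

theorem parity_mul_d : C.parity * C.d = -(C.d * C.parity) := by
  obtain ⟨ι, ⟨B⟩⟩ := C.exists_adaptedBasis
  refine B.ext_F fun n _ _ x hx => ?_
  rw [Module.End.mul_apply, C.parity_apply _ _ (C.d_mem n x hx), LinearMap.neg_apply,
    Module.End.mul_apply, C.parity_apply n x hx, map_zsmul, Int.negOnePow_sub]
  simp

theorem parity_pow_mul_self (i : ℕ) : C.parity ^ i * C.parity ^ i = 1 := by
  rw [← (Commute.refl C.parity).mul_pow, C.parity_mul_self, one_pow]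

theorem parity_pow_mem_cochains (i : ℕ) : C.parity ^ i ∈ cochains C.F 0 := by
  induction i with
  | zero => exact fun n x hx => by simpa using hx
  | succ i ih => simpa [pow_succ] using mul_mem_cochains ih C.parity_mem_cochains

theorem isHomog_parity_pow (i : ℕ) : IsHomog C.gr 0 0 (C.parity ^ i) := by
  induction i with
  | zero => exact fun n k x hx => by simpa using hx
  | succ i ih => simpa [pow_succ] using ih.mul C.isHomog_parity

theorem mul_parity_pow_mem_cochains {q : ℤ} {φ : Module.End S T} (hφ : φ ∈ cochains C.F q)
    (i : ℕ) : φ * C.parity ^ i ∈ cochains C.F q := by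
  simpa using mul_mem_cochains hφ (C.parity_pow_mem_cochains i)

theorem isHomog_mul_parity_pow {q e : ℤ} {φ : Module.End S T} (hφ : IsHomog C.gr q e φ)
    (i : ℕ) : IsHomog C.gr q e (φ * C.parity ^ i) := by
  simpa using hφ.mul (C.isHomog_parity_pow i)

theorem mul_parity_pow_mul_parity_pow (φ : Module.End S T) (i : ℕ) :
    φ * C.parity ^ i * C.parity ^ i = φ := by
  rw [mul_assoc, C.parity_pow_mul_self, mul_one]

theorem parity_pow_mul_d (i : ℕ) :
    C.parity ^ i * C.d = ((i : ℤ).negOnePow : ℤ) • (C.d * C.parity ^ i) := by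
  induction i with
  | zero => simp
  | succ i ih =>
    rw [pow_succ', mul_assoc, ih, mul_smul_comm, ← mul_assoc, C.parity_mul_d]
    push_cast
    rw [Int.negOnePow_succ]
    simp [mul_assoc]

/-- `parity` anticommutes with d, so moving its i-th power past d changes the sign (-1)^q of the
differential into (-1)^(q + i). In degrees i and i + 2 this yields commutators with d, in degree i +
1 anticommutators, as in the equations for isomorphisms, obstructions and lifts. -/
theorem diff_mul_parity_pow (q : ℤ) (i : ℕ) (φ : Module.End S T) :
    diff C.d q (φ * C.parity ^ i) =
      (C.d * φ - ((q + i).negOnePow : ℤ) • (φ * C.d)) * C.parity ^ i := by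
  rw [diff_apply, mul_assoc φ, C.parity_pow_mul_d, mul_smul_comm, smul_smul, ← Units.val_mul,
    ← Int.negOnePow_add, sub_mul, smul_mul_assoc, mul_assoc, mul_assoc]

theorem diff_mul_parity_pow_of_even {q : ℤ} {i : ℕ} (h : Even (q + i)) (φ : Module.End S T) :
    diff C.d q (φ * C.parity ^ i) = (C.d * φ - φ * C.d) * C.parity ^ i := by
  rw [C.diff_mul_parity_pow, Int.negOnePow_even _ h]
  simp

theorem diff_mul_parity_pow_of_odd {q : ℤ} {i : ℕ} (h : Odd (q + i)) (φ : Module.End S T) :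
    diff C.d q (φ * C.parity ^ i) = (C.d * φ + φ * C.d) * C.parity ^ i := by
  rw [C.diff_mul_parity_pow, Int.negOnePow_odd _ h]
  simp

theorem mul_parity_pow_eq_iff (φ ψ : Module.End S T) (i : ℕ) :
    φ * C.parity ^ i = ψ * C.parity ^ i ↔ φ = ψ :=
  ⟨fun h => by rw [← C.mul_parity_pow_mul_parity_pow φ i, h, C.mul_parity_pow_mul_parity_pow],
    fun h => by rw [h]⟩

/-! #### Free flags and iterated deformations -/

variable {C}

theorem IsDeformation.mono {a : ℤ} {i j : ℕ} {δ : ℕ → Module.End S T}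
    (h : C.IsDeformation a j δ) (hij : i ≤ j) : C.IsDeformation a i δ where
  one := h.one
  mem k hk hki := h.mem k hk (hki.trans hij)
  homog k hk hki := h.homog k hk (hki.trans hij)
  sq := by
    rw [stageDiff_sq_eq_zero_iff fun m hm => coeff_stagePoly_of_lt (hm.trans_le hij)]
    exact fun m hm => (stageDiff_sq_eq_zero_iff fun m hm => coeff_stagePoly_of_lt hm).1 h.sq m
      (hm.trans_le hij)

theorem coeff_stagePoly_mem_cochains {N : ℕ} {δ : ℕ → Module.End S T}
    (h : ∀ j : ℕ, 1 ≤ j → j ≤ N → δ j ∈ cochains C.F j) (m : ℕ) :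
    (stagePoly δ N).coeff m ∈ cochains C.F (m + 1) := by
  rw [coeff_stagePoly]
  split_ifs with hm
  · exact_mod_cast h (m + 1) (by omega) hm
  · exact zero_mem _

theorem coeff_stagePoly_sq_mem_cochains {N : ℕ} {δ : ℕ → Module.End S T}
    (h : ∀ j : ℕ, 1 ≤ j → j ≤ N → δ j ∈ cochains C.F j) (m : ℕ) :
    (stagePoly δ N * stagePoly δ N).coeff m ∈ cochains C.F (m + 2) := by
  rw [Polynomial.coeff_mul]
  refine Submodule.sum_mem _ fun jk hjk => ?_
  rw [Finset.HasAntidiagonal.mem_antidiagonal] at hjk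
  have := mul_mem_cochains (coeff_stagePoly_mem_cochains h jk.1)
    (coeff_stagePoly_mem_cochains h jk.2)
  rwa [show ((jk.1 : ℤ) + 1 + (jk.2 + 1)) = m + 2 by omega] at this

namespace AdaptedBasis

variable {ι : Type} (B : C.AdaptedBasis ι)

/-- The coefficients lie in distinct homological degrees, so each one is recovered from the value at
t = 1 as a component. -/
theorem eq_zero_of_evalOne (B : C.AdaptedBasis ι) {p : (Module.End S T)[X]} {c : ℤ}
    (hp : ∀ m : ℕ, p.coeff m ∈ cochains C.F (m + c)) (h : evalOne _ p = 0) : p = 0 := by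
  ext1 m
  have := congrArg (B.comp (m + c)) h
  rw [evalOne_apply, Polynomial.sum, map_sum, map_zero, Finset.sum_eq_single m] at this
  · rw [← B.comp_of_mem (hp m), this, Polynomial.coeff_zero]
  · intro k _ hk
    exact B.comp_of_mem_ne (hp k) (by simpa using hk)
  · intro hm
    rw [Polynomial.notMem_support_iff.1 hm, map_zero]

theorem pr_of_mem_iSup {p : ℤ → Prop} {x : T} (hx : x ∈ ⨆ m : {m : ℤ // p m}, C.F m) {n : ℤ}
    (hn : ¬ p n) : B.pr n x = 0 := by
  refine B.b.ext_elem fun i => ?_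
  rw [repr_pr]
  split_ifs with h
  · rw [(B.mem_iSup_F p x).1 hx i (h ▸ hn)]
    simp
  · simp

/-- The terms δ_j are the homological components of D. The square of their polynomial takes the
value D² = 0 at t = 1, and its coefficients lie in the degrees m + 2, so it vanishes identically. -/
theorem isDeformation_of_isAnchoredFlag [GradedRing 𝒜] {a : ℤ} {D : Module.End S T}
    (hD : C.IsAnchoredFlag a D) {N : ℕ} (hN : C.len ≤ N) :
    C.IsDeformation a N (fun j => B.comp j D) ∧
      D = ∑ m ∈ Finset.range N, B.comp (m + 1 : ℕ) D := by
  have hsum : D = ∑ m ∈ Finset.range N, B.comp (m + 1 : ℕ) D := by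
    refine B.ext_F fun n hn hn' x hx => B.b.ext_elem fun i => ?_
    rw [LinearMap.sum_apply, map_sum, Finset.sum_apply']
    simp_rw [B.comp_apply _ D hx, B.repr_pr]
    have h0 := B.h_nonneg i
    by_cases hi : B.h i < n
    -- On F n, only the component of degree m + 1 = n - h i contributes to the i-th coordinate; here
    -- m < N because h i ≥ 0 and n ≤ `len` ≤ N.
    · rw [Finset.sum_eq_single (n - B.h i - 1).toNat]
      · rw [if_pos]
        push_cast
        omega
      · intro m _ hm
        rw [if_neg]
        push_cast
        omega
      · intro hm
        rw [Finset.mem_range] at hm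
        omega
    · rw [(B.mem_iSup_F _ _).1 (hD.lower n x hx) i hi, Finset.sum_eq_zero]
      intros
      split_ifs <;> rfl
  refine ⟨⟨?_, fun j _ _ => B.comp_mem _ _, fun j _ _ n k x hx => ?_, ?_⟩, hsum⟩
  · refine B.ext_F fun n _ _ x hx => ?_
    rw [B.comp_apply _ D hx]
    have h1 := B.pr_of_mem_iSup (hD.anchor n x hx) (n := n - 1) (by simp)
    rw [map_sub, B.pr_of_mem (C.d_mem n x hx), sub_eq_zero] at h1
    exact_mod_cast h1
  · have hxF := C.mem_F_of_mem_gr hx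
    rw [B.comp_apply _ D hxF]
    refine (B.mem_gr _ _ _).2 ⟨B.pr_mem _ _, fun i => ?_⟩
    rw [B.repr_pr]
    split_ifs with hi
    · have := (B.mem_foldGr _ _ _).1 (hD.homog _ _ ((B.mem_gr_iff a n k x).1 hx).2) i
      rw [hi] at this
      convert this using 2
      ring
    · exact zero_mem _
  · rw [stageDiff_sq_eq_zero_iff fun m hm => coeff_stagePoly_of_lt hm]
    have : stagePoly (fun j : ℕ => B.comp j D) N * stagePoly (fun j : ℕ => B.comp j D) N = 0 := by
      refine B.eq_zero_of_evalOne (c := 2)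
        (coeff_stagePoly_sq_mem_cochains fun j _ _ => B.comp_mem _ _) ?_
      rw [map_mul, evalOne_stagePoly, ← hsum, hD.sq]
    simp [this]

end AdaptedBasis

theorem IsDeformation.isAnchoredFlag {a : ℤ} {N : ℕ} {δ : ℕ → Module.End S T}
    (h : C.IsDeformation a N δ) (hN : C.len ≤ N) (hN' : 1 ≤ N) :
    C.IsAnchoredFlag a (∑ m ∈ Finset.range N, δ (m + 1)) where
  sq := by
    obtain ⟨ι, ⟨B⟩⟩ := C.exists_adaptedBasis
    have : stagePoly δ N * stagePoly δ N = 0 := by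
      ext1 m
      by_cases hm : m < N
      · exact (stageDiff_sq_eq_zero_iff fun m hm => coeff_stagePoly_of_lt hm).1 h.sq m hm
      -- Beyond the truncation the coefficient has degree m + 2 > `len`, so it vanishes without any
      -- equation.
      · exact B.cochains_eq_zero (q := m + 2) (by omega) (coeff_stagePoly_sq_mem_cochains h.mem m)
    rw [← evalOne_stagePoly, ← map_mul, this, map_zero]
  homog k x hx := by
    rw [LinearMap.sum_apply]
    refine sum_mem fun m hm => ?_
    rw [Finset.mem_range] at hm
    have hle : foldGr C.gr a k ≤ (foldGr C.gr a (k + a)).comap (δ (m + 1)).toAddMonoidHom := by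
      refine iSup_le fun n x hx => ?_
      have := h.homog (m + 1) (by omega) hm _ _ _ hx
      refine AddSubgroup.mem_iSup_of_mem (n - (m + 1 : ℕ)) ?_
      change δ (m + 1) x ∈ _
      convert this using 2
      push_cast
      ring
    exact hle hx
  lower n x hx := by
    rw [LinearMap.sum_apply]
    refine sum_mem fun m hm => ?_
    rw [Finset.mem_range] at hm
    exact Submodule.mem_iSup_of_mem (p := fun m : {m : ℤ // m < n} => C.F m)
      ⟨n - (m + 1 : ℕ), by omega⟩ (h.mem (m + 1) (by omega) hm n x hx)
  anchor n x hx := by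
    obtain ⟨M, rfl⟩ : ∃ M, N = M + 1 := ⟨N - 1, by omega⟩
    rw [Finset.sum_range_succ', h.one, LinearMap.add_apply, add_sub_cancel_right,
      LinearMap.sum_apply]
    refine sum_mem fun m hm => ?_
    rw [Finset.mem_range] at hm
    exact Submodule.mem_iSup_of_mem (p := fun m : {m : ℤ // m < n - 1} => C.F m)
      ⟨n - (m + 1 + 1 : ℕ), by push_cast; omega⟩ (h.mem (m + 1 + 1) (by omega) (by omega) n x hx)

/-- If `len = 0`, the sum on the left is empty and the one on the right is d, which is then zero.
This allows stage `max 1 len` to be used uniformly. -/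
theorem sum_Icc_eq_of_len_le (δ : ℕ → Module.End S T) (h1 : δ 1 = C.d) :
    ∑ j ∈ Finset.Icc 1 C.len, δ j = ∑ m ∈ Finset.range (max 1 C.len), δ (m + 1) := by
  have : ∀ N : ℕ, ∑ m ∈ Finset.range N, δ (m + 1) = ∑ j ∈ Finset.Icc 1 N, δ j := fun N => by
    rw [Finset.range_eq_Ico, Finset.sum_Ico_add' δ 0 N 1]
    rfl
  rw [this]
  rcases Nat.eq_zero_or_pos C.len with h | h
  · obtain ⟨ι, ⟨B⟩⟩ := C.exists_adaptedBasis
    rw [h]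
    simp [h1, B.cochains_eq_zero (by omega) C.d_mem_cochains]
  · rw [max_eq_right h]

/-- The last lift contains all earlier ones as truncations, so the whole chain of lifts is one
deformation over the final stage. -/
theorem isIteratedDeformation_iff {a : ℤ} {δ : ℕ → Module.End S T} {D : Module.End S T} :
    C.IsIteratedDeformation a δ D ↔ C.IsDeformation a (max 1 C.len) δ ∧
      D = ∑ m ∈ Finset.range (max 1 C.len), δ (m + 1) := by
  constructor
  · intro h
    refine ⟨?_, h.specialize.trans (sum_Icc_eq_of_len_le δ h.start.one)⟩
    by_cases hl : C.len ≤ 1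
    · rw [max_eq_left hl]
      exact h.start
    · have := h.step (C.len - 1) (by omega) (by omega)
      rw [IsLift, Function.update_eq_self, Nat.sub_add_cancel (by omega)] at this
      rwa [max_eq_right (by omega)]
  · rintro ⟨h, hD⟩
    refine ⟨h.mono (le_max_left _ _), fun i hi hil => ?_,
      hD.trans (sum_Icc_eq_of_len_le δ h.one).symm⟩
    rw [IsLift, Function.update_eq_self]
    exact h.mono (by omega)

variable (C)

theorem isAnchoredFlag_iff [GradedRing 𝒜] (a : ℤ) (D : Module.End S T) :
    C.IsAnchoredFlag a D ↔ ∃ δ, C.IsIteratedDeformation a δ D := by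
  obtain ⟨ι, ⟨B⟩⟩ := C.exists_adaptedBasis
  constructor
  · intro h
    exact ⟨_, isIteratedDeformation_iff.2 (B.isDeformation_of_isAnchoredFlag h (le_max_right _ _))⟩
  · rintro ⟨δ, h⟩
    obtain ⟨h', rfl⟩ := isIteratedDeformation_iff.1 h
    exact h'.isAnchoredFlag (le_max_right _ _) (le_max_left _ _)

/-! #### Obstructions -/

variable {C}

/-- Expand the square of P + t^i y: below t^i nothing changes, and at t^i the cross terms contribute
dy + yd. -/
theorem isLift_iff {a : ℤ} {i : ℕ} (hi : 1 ≤ i) {δ : ℕ → Module.End S T}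
    (h : C.IsDeformation a i δ) (y : Module.End S T) :
    C.IsLift a i δ y ↔ y ∈ cochains C.F (i + 1) ∧ IsHomog C.gr (i + 1) (a - (i + 1) * a) y ∧
      ∑ j ∈ Finset.Icc 2 i, δ j * δ (i + 2 - j) + (C.d * y + y * C.d) = 0 := by
  have hsq := (stageDiff_sq_eq_zero_iff fun m hm => coeff_stagePoly_of_lt hm).1 h.sq
  have hP0 : (stagePoly δ i).coeff 0 = C.d := by rw [coeff_stagePoly_of_lt hi, zero_add, h.one]
  have hmon := coeff_monomial_of_lt (i := i) y
  have hcoeff : ∀ m ≤ i, ((stagePoly δ i + Polynomial.monomial i y) *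
      (stagePoly δ i + Polynomial.monomial i y)).coeff m =
      (stagePoly δ i * stagePoly δ i).coeff m + (C.d * (Polynomial.monomial i y).coeff m +
        (Polynomial.monomial i y).coeff m * C.d) := by
    intro m hm
    rw [add_mul, mul_add, Polynomial.coeff_add, Polynomial.coeff_add,
      coeff_mul_of_coeff_right_eq_zero hmon hm, coeff_mul_of_coeff_left_eq_zero hmon hm,
      Polynomial.coeff_add, hP0, hmon 0 (by omega), add_zero, add_assoc]
  have hsq_iff : stageDiff (Function.update δ (i + 1) y) (i + 1) *
      stageDiff (Function.update δ (i + 1) y) (i + 1) = 0 ↔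
      ∑ j ∈ Finset.Icc 2 i, δ j * δ (i + 2 - j) + (C.d * y + y * C.d) = 0 := by
    rw [stageDiff_sq_eq_zero_iff fun m hm => coeff_stagePoly_of_lt hm, stagePoly_update]
    constructor
    · intro H
      have := H i (by omega)
      rwa [hcoeff i le_rfl, coeff_stagePoly_mul_self, Polynomial.coeff_monomial_same] at this
    · intro H m hm
      rw [hcoeff m (by omega)]
      rcases Nat.lt_succ_iff_lt_or_eq.1 hm with hm | rfl
      · rw [hmon m hm, hsq m hm]
        simp
      · rwa [coeff_stagePoly_mul_self, Polynomial.coeff_monomial_same]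
  constructor
  · intro H
    refine ⟨?_, ?_, hsq_iff.1 H.sq⟩
    · have := H.mem (i + 1) (by omega) le_rfl
      rw [Function.update_self] at this
      exact_mod_cast this
    · have := H.homog (i + 1) (by omega) le_rfl
      rw [Function.update_self] at this
      exact_mod_cast this
  · rintro ⟨h1, h2, h3⟩
    refine ⟨?_, fun j hj hji => ?_, fun j hj hji => ?_, hsq_iff.2 h3⟩
    · rw [Function.update_of_ne (by omega), h.one]
    · by_cases hne : j = i + 1
      · subst hne
        rw [Function.update_self]
        exact_mod_cast h1
      · rw [Function.update_of_ne hne]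
        exact h.mem j hj (by omega)
    · by_cases hne : j = i + 1
      · subst hne
        rw [Function.update_self]
        exact_mod_cast h2
      · rw [Function.update_of_ne hne]
        exact h.homog j hj (by omega)

/-- P² starts at t^i. Comparing the t^i-coefficients of P · P² and P² · P shows that d commutes with
the coefficient of P², which the twist turns into the cocycle condition. -/
theorem IsDeformation.obstruction_mem_cocycles {a : ℤ} {i : ℕ} (hi : 1 ≤ i)
    {δ : ℕ → Module.End S T} (h : C.IsDeformation a i δ) :
    C.obstruction i δ ∈ cocycles C.F C.d (i + 2) := by
  have hsq := (stageDiff_sq_eq_zero_iff fun m hm => coeff_stagePoly_of_lt hm).1 h.sq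
  have hP0 : (stagePoly δ i).coeff 0 = C.d := by rw [coeff_stagePoly_of_lt hi, zero_add, h.one]
  refine ⟨C.mul_parity_pow_mem_cochains ?_ i, ?_⟩
  · rw [← coeff_stagePoly_mul_self]
    exact neg_mem (coeff_stagePoly_sq_mem_cochains h.mem i)
  · change diff C.d (i + 2) (C.obstruction i δ) = 0
    rw [obstruction, C.diff_mul_parity_pow_of_even ⟨i + 1, by ring⟩,
      ← coeff_stagePoly_mul_self]
    have h1 := coeff_mul_of_coeff_right_eq_zero (p := stagePoly δ i) hsq le_rfl
    have h2 := coeff_mul_of_coeff_left_eq_zero (q := stagePoly δ i) hsq le_rfl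
    rw [hP0] at h1 h2
    rw [mul_neg, neg_mul, ← h1, ← h2, mul_assoc, sub_self, zero_mul]

theorem IsDeformation.isHomog_obstruction {a : ℤ} {i : ℕ} {δ : ℕ → Module.End S T}
    (h : C.IsDeformation a i δ) :
    IsHomog C.gr (i + 2) (2 * a - (i + 2) * a) (C.obstruction i δ) := by
  refine C.isHomog_mul_parity_pow (IsHomog.neg (IsHomog.sum _ fun j hj => ?_)) i
  rw [Finset.mem_Icc] at hj
  have := (h.homog j (by omega) hj.2).mul (h.homog (i + 2 - j) (by omega) (by omega))
  rw [Nat.cast_sub (by omega)] at this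
  push_cast at this
  convert this using 1 <;> ring

/-- After the twist, the equation for y says that the obstruction is the coboundary of y. A bounding
cochain need not be homogeneous, but the obstruction is, so the part of the right internal degree
bounds it as well. -/
theorem IsDeformation.exists_isLift_iff [GradedRing 𝒜] {a : ℤ} {i : ℕ} (hi : 1 ≤ i)
    {δ : ℕ → Module.End S T} (h : C.IsDeformation a i δ) :
    (∃ y, C.IsLift a i δ y) ↔
      cls C.F C.d (i + 2) ⟨C.obstruction i δ, h.obstruction_mem_cocycles hi⟩ = 0 := by
  rw [cls_eq_zero_iff, mem_coboundaries (q := i + 1) (by ring)]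
  constructor
  · rintro ⟨y, hy⟩
    obtain ⟨h1, -, h3⟩ := (isLift_iff hi h y).1 hy
    refine ⟨y * C.parity ^ i, C.mul_parity_pow_mem_cochains h1 i, ?_⟩
    change _ = C.obstruction i δ
    rw [C.diff_mul_parity_pow_of_odd ⟨i, by ring⟩, obstruction, mul_parity_pow_eq_iff]
    exact eq_neg_of_add_eq_zero_right h3
  · rintro ⟨φ, hφ, hd⟩
    change _ = C.obstruction i δ at hd
    have hh : IsHomog C.gr (i + 1 + 1) (a - (i + 1) * a) (diff C.d (i + 1) φ) := by
      rw [hd]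
      convert h.isHomog_obstruction using 1 <;> ring
    obtain ⟨ψ, hψ, hψh, hψd⟩ := C.exists_homog_of_diff hφ hh
    refine ⟨ψ * C.parity ^ i, (isLift_iff hi h _).2 ⟨C.mul_parity_pow_mem_cochains hψ i,
      C.isHomog_mul_parity_pow hψh i, ?_⟩⟩
    rw [hd] at hψd
    rw [← C.mul_parity_pow_mul_parity_pow ψ i, C.diff_mul_parity_pow_of_odd ⟨i, by ring⟩,
      obstruction] at hψd
    rw [(C.mul_parity_pow_eq_iff _ _ i).1 hψd, add_neg_cancel]

end GradedFreeComplex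

namespace GradedFreeComplex

open EndComplex TruncPoly

variable {S : Type u} [CommRing S] {𝒜 : ℤ → AddSubgroup S}
  {T : Type u} [AddCommGroup T] [Module S T] {C : GradedFreeComplex 𝒜 T}

/-! #### Isomorphisms of lifts -/

theorem AdaptedBasis.pr_d {ι : Type} (B : C.AdaptedBasis ι) (n : ℤ) (x : T) :
    B.pr (n - 1) (C.d x) = C.d (B.pr n x) := by
  suffices B.pr (n - 1) ∘ₗ C.d = C.d ∘ₗ B.pr n from LinearMap.congr_fun this x
  refine B.ext_F fun m _ _ x hx => ?_
  rw [LinearMap.comp_apply, LinearMap.comp_apply]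
  by_cases h : m = n
  · subst h
    rw [B.pr_of_mem hx, B.pr_of_mem (C.d_mem m x hx)]
  · rw [B.pr_of_mem_ne hx h, B.pr_of_mem_ne (C.d_mem m x hx) (by omega), map_zero]

/-- The two products can differ only at t^i, where they contribute y + Vd and y' + dV. -/
theorem evalEnd_intertwine_iff {i : ℕ} (hi : 1 ≤ i) {δ : ℕ → Module.End S T} (h1 : δ 1 = C.d)
    (y y' V : Module.End S T) :
    evalEnd S T (i + 1) (1 + Polynomial.monomial i V) * liftDiff i δ y =
      liftDiff i δ y' * evalEnd S T (i + 1) (1 + Polynomial.monomial i V) ↔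
    y - y' = C.d * V - V * C.d := by
  have hl : ∀ y, liftDiff i δ y =
      evalEnd S T (i + 1) (stagePoly δ i + Polynomial.monomial i y) := fun y => by
    rw [liftDiff, ← stagePoly_update]
    exact stageDiff_eq_evalEnd fun m hm => coeff_stagePoly_of_lt hm
  have hP0 : (stagePoly δ i).coeff 0 = C.d := by rw [coeff_stagePoly_of_lt hi, zero_add, h1]
  have hmon := fun y : Module.End S T => coeff_monomial_of_lt (i := i) y
  have h0 : ∀ y : Module.End S T, (stagePoly δ i + Polynomial.monomial i y).coeff 0 = C.d :=
    fun y => by rw [Polynomial.coeff_add, hP0, hmon y 0 (by omega), add_zero]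
  rw [hl, hl, ← map_mul, ← map_mul, evalEnd_eq_iff]
  have e1 : ∀ m ≤ i, ((1 + Polynomial.monomial i V) *
      (stagePoly δ i + Polynomial.monomial i y)).coeff m = (stagePoly δ i).coeff m +
        (Polynomial.monomial i y).coeff m + (Polynomial.monomial i V).coeff m * C.d :=
    fun m hm => by
      rw [add_mul, one_mul, Polynomial.coeff_add, coeff_mul_of_coeff_left_eq_zero (hmon V) hm, h0,
        Polynomial.coeff_add]
  have e2 : ∀ m ≤ i, ((stagePoly δ i + Polynomial.monomial i y') *
      (1 + Polynomial.monomial i V)).coeff m = (stagePoly δ i).coeff m +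
        (Polynomial.monomial i y').coeff m + C.d * (Polynomial.monomial i V).coeff m :=
    fun m hm => by
      rw [mul_add, mul_one, Polynomial.coeff_add, coeff_mul_of_coeff_right_eq_zero (hmon V) hm, h0,
        Polynomial.coeff_add]
  constructor
  · intro H
    have := H i (by omega)
    rw [e1 i le_rfl, e2 i le_rfl] at this
    simp only [Polynomial.coeff_monomial_same, add_assoc, add_right_inj] at this
    rw [sub_eq_sub_iff_add_eq_add, this, add_comm]
  · intro H m hm
    rw [e1 m (by omega), e2 m (by omega)]
    rcases Nat.lt_succ_iff_lt_or_eq.1 hm with hm | rfl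
    · rw [hmon y m hm, hmon V m hm, hmon y' m hm]
      simp
    · simp only [Polynomial.coeff_monomial_same, add_assoc, add_right_inj]
      rw [sub_eq_sub_iff_add_eq_add] at H
      rw [H, add_comm]

/-- Being the identity modulo t^i, the isomorphism is 1 + t^i V for some endomorphism V. As y - y'
has homological degree i + 1 and d has degree 1, the component of V of degree i satisfies the same
equation. -/
theorem LiftIso.exists_cochain {a : ℤ} {i : ℕ} (hi : 1 ≤ i) {δ : ℕ → Module.End S T}
    (h1 : δ 1 = C.d) {y y' : Module.End S T} (hy : y ∈ cochains C.F (i + 1))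
    (hy' : y' ∈ cochains C.F (i + 1)) (h : C.LiftIso a i δ y y') :
    ∃ V ∈ cochains C.F i, y - y' = C.d * V - V * C.d := by
  obtain ⟨P, hP, -, hmod⟩ := h
  obtain ⟨p, hp⟩ := evalEnd_surjective (S := S) (T := T) (i + 1) P.toLinearMap
  have hp' : evalEnd S T (i + 1) (1 + Polynomial.monomial i (p.coeff i)) = P.toLinearMap := by
    rw [← hp, evalEnd_eq_iff]
    intro m hm
    rw [Polynomial.coeff_add]
    rcases Nat.lt_succ_iff_lt_or_eq.1 hm with hm' | rfl
    · rw [coeff_monomial_of_lt _ m hm', add_zero]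
      ext x
      rw [← tensorCoeff_evalEnd hm, ← tensorCoeff_evalEnd hm, hp, map_one, eq_comm, ← sub_eq_zero,
        ← map_sub]
      obtain ⟨w, hw⟩ := hmod (1 ⊗ₜ x)
      change tensorCoeff S T (i + 1) m (P (1 ⊗ₜ x) - 1 ⊗ₜ x) = 0
      rw [hw, tensorCoeff_t_pow_smul_of_lt hm']
    · rw [Polynomial.coeff_monomial_same, Polynomial.coeff_one, if_neg (by omega), zero_add]
  have H := (evalEnd_intertwine_iff hi h1 y y' (p.coeff i)).1 (by
    rw [hp']
    exact LinearMap.ext hP)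
  obtain ⟨ι, ⟨B⟩⟩ := C.exists_adaptedBasis
  refine ⟨B.comp i (p.coeff i), B.comp_mem _ _, ?_⟩
  rw [← B.comp_of_mem (sub_mem hy hy'), H]
  refine B.ext_F fun n _ _ x hx => ?_
  rw [B.comp_apply _ _ hx, LinearMap.sub_apply, LinearMap.sub_apply, Module.End.mul_apply,
    Module.End.mul_apply, Module.End.mul_apply, Module.End.mul_apply, B.comp_apply _ _ hx,
    B.comp_apply _ _ (C.d_mem n x hx), ← B.pr_d, map_sub]
  congr 3 <;> ring

theorem liftIso_of_isHomog {a : ℤ} {i : ℕ} (hi : 1 ≤ i) {δ : ℕ → Module.End S T}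
    (h1 : δ 1 = C.d) {y y' V : Module.End S T} (hV : IsHomog C.gr i (a - (i + 1) * a) V)
    (h : y - y' = C.d * V - V * C.d) : C.LiftIso a i δ y y' := by
  -- The inverse of 1 + t^i V is 1 - t^i V, because i ≥ 1 gives t^(2i) = 0.
  have hmul : ∀ V W : Module.End S T, V + W = 0 →
      evalEnd S T (i + 1) (1 + Polynomial.monomial i V) *
        evalEnd S T (i + 1) (1 + Polynomial.monomial i W) = 1 := by
    intro V W hVW
    rw [← map_mul, ← map_one (evalEnd S T (i + 1)), evalEnd_eq_iff]
    intro m hm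
    rw [add_mul, one_mul, mul_add, mul_one, Polynomial.coeff_add, Polynomial.coeff_add,
      Polynomial.coeff_add,
      coeff_mul_of_coeff_left_eq_zero (coeff_monomial_of_lt (i := i) V) (by omega),
      coeff_monomial_of_lt (i := i) W 0 hi, mul_zero, add_zero, add_assoc, ← Polynomial.coeff_add,
      ← map_add, add_comm W, hVW]
    simp
  have happly : ∀ z, evalEnd S T (i + 1) (1 + Polynomial.monomial i V) z =
      z + t S (i + 1) ^ i • V.baseChange (TruncPoly S (i + 1)) z := fun z => by
    rw [map_add, map_one, evalEnd_monomial]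
    rfl
  refine ⟨LinearEquiv.ofLinearMap (evalEnd S T (i + 1) (1 + Polynomial.monomial i V))
    (evalEnd S T (i + 1) (1 + Polynomial.monomial i (-V))) (hmul _ _ (add_neg_cancel V))
    (hmul _ _ (neg_add_cancel V)), ?_, fun k z hz => ?_, fun z => ⟨V.baseChange _ z, ?_⟩⟩
  · exact LinearMap.congr_fun ((evalEnd_intertwine_iff hi h1 y y' V).2 h)
  · have hle : foldGr (C.truncGr (i + 1)) a k ≤ (foldGr (C.truncGr (i + 1)) a k).comap
        (evalEnd S T (i + 1) (1 + Polynomial.monomial i V)).toAddMonoidHom := by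
      refine iSup_le fun n z hz => ?_
      change evalEnd S T (i + 1) (1 + Polynomial.monomial i V) z ∈
        foldGr (C.truncGr (i + 1)) a k
      rw [happly]
      -- V lowers n by i and changes the internal degree by -ia, so it preserves the degree of the
      -- fold.
      refine add_mem (AddSubgroup.mem_iSup_of_mem n hz) (AddSubgroup.mem_iSup_of_mem (n - i) ?_)
      have := C.t_pow_smul_mem_truncGr (i + 1) i (C.isHomog_baseChange hV (i + 1) _ _ _ hz)
      convert this using 2
      ring
    exact hle hz
  · rw [LinearEquiv.coe_ofLinearMap, happly, add_sub_cancel_left]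

theorem liftIso_iff [GradedRing 𝒜] {a : ℤ} {i : ℕ} (hi : 1 ≤ i) {δ : ℕ → Module.End S T}
    (h : C.IsDeformation a i δ) {y y' : Module.End S T} (hy : C.IsLift a i δ y)
    (hy' : C.IsLift a i δ y') :
    C.LiftIso a i δ y y' ↔ (y - y') * C.parity ^ i ∈ coboundaries C.F C.d (i + 1) := by
  obtain ⟨h1, h2, -⟩ := (isLift_iff hi h y).1 hy
  obtain ⟨h1', h2', -⟩ := (isLift_iff hi h y').1 hy'
  rw [mem_coboundaries (q := i) rfl]
  constructor
  · intro H
    obtain ⟨V, hV, hd⟩ := H.exists_cochain hi h.one h1 h1'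
    exact ⟨V * C.parity ^ i, C.mul_parity_pow_mem_cochains hV i, by
      rw [C.diff_mul_parity_pow_of_even ⟨i, rfl⟩, hd]⟩
  · rintro ⟨φ, hφ, hd⟩
    obtain ⟨ψ, -, hψh, hψd⟩ := C.exists_homog_of_diff hφ
      (hd ▸ C.isHomog_mul_parity_pow (h2.sub h2') i)
    refine liftIso_of_isHomog hi h.one (C.isHomog_mul_parity_pow hψh i) ?_
    rw [hd, ← C.mul_parity_pow_mul_parity_pow ψ i, C.diff_mul_parity_pow_of_even ⟨i, rfl⟩,
      mul_parity_pow_eq_iff] at hψd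
    exact hψd.symm

theorem IsLift.sub_mem_cocycles {a : ℤ} {i : ℕ} (hi : 1 ≤ i) {δ : ℕ → Module.End S T}
    (h : C.IsDeformation a i δ) {x y : Module.End S T} (hx : C.IsLift a i δ x)
    (hy : C.IsLift a i δ y) : (y - x) * C.parity ^ i ∈ cocycles C.F C.d (i + 1) := by
  obtain ⟨h1, -, h3⟩ := (isLift_iff hi h y).1 hy
  obtain ⟨h1', -, h3'⟩ := (isLift_iff hi h x).1 hx
  refine mem_cocycles.2 ⟨C.mul_parity_pow_mem_cochains (sub_mem h1 h1') i, ?_⟩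
  rw [C.diff_mul_parity_pow_of_odd ⟨i, by ring⟩]
  have : C.d * (y - x) + (y - x) * C.d = 0 := by
    rw [mul_sub, sub_mul, ← sub_eq_zero.2 (h3.trans h3'.symm)]
    abel
  rw [this, zero_mul]

/-- The condition on a lift is affine in y, so the lifts are x plus the homogeneous maps
anticommuting with d, that is, plus twisted homogeneous cocycles. A cocycle z is realised by x + z ·
parity^i, since parity^i is its own inverse. -/
theorem exists_lift_parametrization [GradedRing 𝒜] {a : ℤ} {i : ℕ} (hi : 1 ≤ i)
    {δ : ℕ → Module.End S T} (h : C.IsDeformation a i δ) {x : Module.End S T}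
    (hx : C.IsLift a i δ x) :
    ∃ Φ : {y : Module.End S T // C.IsLift a i δ y} → HDeg C.F C.gr C.d (i + 1) (a - (i + 1) * a),
      (∀ y, ∃ hz : (y.1 - x) * C.parity ^ i ∈ cocycles C.F C.d (i + 1),
        (Φ y : H C.F C.d (i + 1)) = cls C.F C.d (i + 1) ⟨(y.1 - x) * C.parity ^ i, hz⟩) ∧
      Function.Surjective Φ ∧ ∀ y y', Φ y = Φ y' ↔ C.LiftIso a i δ y.1 y'.1 := by
  obtain ⟨h1, h2, h3⟩ := (isLift_iff hi h x).1 hx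
  refine ⟨fun y => ⟨cls C.F C.d (i + 1) ⟨_, hx.sub_mem_cocycles hi h y.2⟩, ⟨_,
    C.isHomog_mul_parity_pow (((isLift_iff hi h y.1).1 y.2).2.1.sub h2) i, rfl⟩⟩,
    fun y => ⟨_, rfl⟩, ?_, fun y y' => ?_⟩
  · rintro ⟨_, z, hz, rfl⟩
    obtain ⟨hzc, hzd⟩ := mem_cocycles.1 z.2
    have hy : C.IsLift a i δ (x + z.1 * C.parity ^ i) := by
      refine (isLift_iff hi h _).2 ⟨add_mem h1 (C.mul_parity_pow_mem_cochains hzc i),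
        h2.add (C.isHomog_mul_parity_pow hz i), ?_⟩
      rw [← C.mul_parity_pow_mul_parity_pow z.1 i, C.diff_mul_parity_pow_of_odd ⟨i, by ring⟩,
        ← zero_mul (C.parity ^ i), mul_parity_pow_eq_iff] at hzd
      rw [← h3, mul_add, add_mul, ← add_zero (∑ j ∈ Finset.Icc 2 i, δ j * δ (i + 2 - j) +
        (C.d * x + x * C.d)), ← hzd]
      abel
    refine ⟨⟨_, hy⟩, Subtype.ext ?_⟩
    refine congrArg (cls C.F C.d (i + 1)) (Subtype.ext ?_)
    change (x + z.1 * C.parity ^ i - x) * C.parity ^ i = z.1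
    rw [add_sub_cancel_left, C.mul_parity_pow_mul_parity_pow]
  · rw [liftIso_iff hi h y.2 y'.2, Subtype.ext_iff, cls_eq_iff]
    change (y.1 - x) * C.parity ^ i - (y'.1 - x) * C.parity ^ i ∈ _ ↔ _
    rw [← sub_mul, sub_sub_sub_cancel_right]

/-! #### Comparison with the endomorphism complex over `S[t] / (t ^ N)` -/

variable (C)

theorem evalEnd_mem_cocycles_iff {N : ℕ} {q : ℤ} {p : (Module.End S T)[X]} :
    evalEnd S T N p ∈ cocycles (C.truncF N) (C.truncD N) q ↔
      ∀ m < N, p.coeff m ∈ cocycles C.F C.d q := by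
  simp only [mem_cocycles, C.evalEnd_mem_cochains_iff, C.diff_evalEnd,
    ← map_zero (evalEnd S T N), evalEnd_eq_iff, C.coeff_diff, Polynomial.coeff_zero]
  exact ⟨fun h m hm => ⟨h.1 m hm, h.2 m hm⟩,
    fun h => ⟨fun m hm => (h m hm).1, fun m hm => (h m hm).2⟩⟩

theorem coeff_mem_coboundaries {N : ℕ} {q : ℤ} {p : (Module.End S T)[X]}
    (h : evalEnd S T N p ∈ coboundaries (C.truncF N) (C.truncD N) q) {m : ℕ} (hm : m < N) :
    p.coeff m ∈ coboundaries C.F C.d q := by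
  obtain ⟨w, hw, hwp⟩ := h
  obtain ⟨r, rfl⟩ := evalEnd_surjective N w
  rw [C.diff_evalEnd, evalEnd_eq_iff] at hwp
  rw [← hwp m hm, C.coeff_diff]
  exact ⟨_, C.evalEnd_mem_cochains_iff.1 hw m hm, rfl⟩

theorem baseChange_mem_cocycles (N : ℕ) {q : ℤ} {z : Module.End S T}
    (hz : z ∈ cocycles C.F C.d q) :
    z.baseChange (TruncPoly S N) ∈ cocycles (C.truncF N) (C.truncD N) q := by
  rw [← evalEnd_C, C.evalEnd_mem_cocycles_iff]
  intro m _
  rw [Polynomial.coeff_C]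
  split_ifs
  · exact hz
  · exact zero_mem _

theorem baseChange_mem_coboundaries (N : ℕ) {q : ℤ} {z : Module.End S T}
    (hz : z ∈ coboundaries C.F C.d q) :
    z.baseChange (TruncPoly S N) ∈ coboundaries (C.truncF N) (C.truncD N) q := by
  obtain ⟨w, hw, rfl⟩ := hz
  refine ⟨w.baseChange (TruncPoly S N), ?_, ?_⟩
  · rw [← evalEnd_C]
    refine C.evalEnd_mem_cochains_iff.2 fun m _ => ?_
    rw [Polynomial.coeff_C]
    split_ifs
    · exact hw
    · exact zero_mem _
  · rw [← evalEnd_C, ← evalEnd_C, C.diff_evalEnd, evalEnd_eq_iff]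
    intro m _
    rw [C.coeff_diff, Polynomial.coeff_C, Polynomial.coeff_C]
    split_ifs
    · rfl
    · exact map_zero _

/-- The map `z ↦ t ^ m [z ⊗ 1]` on cocycles. -/
def cocyclesToTrunc (N m : ℕ) (q : ℤ) :
    cocycles C.F C.d q →ₗ[S] H (C.truncF N) (C.truncD N) q where
  toFun z := t S N ^ m •
    cls (C.truncF N) (C.truncD N) q ⟨_, C.baseChange_mem_cocycles N z.2⟩
  map_add' z w := by
    rw [← smul_add, ← map_add]
    congr 2
    exact Subtype.ext (LinearMap.baseChange_add z.1 w.1)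
  map_smul' c z := by
    rw [RingHom.id_apply, smul_comm c]
    refine congrArg (t S N ^ m • ·) (Eq.trans (congrArg _ (Subtype.ext ?_))
      ((cls (C.truncF N) (C.truncD N) q).map_smul_of_tower c
        ⟨_, C.baseChange_mem_cocycles N z.2⟩))
    exact LinearMap.baseChange_smul c z.1

/-- The map `[z] ↦ t ^ m [z ⊗ 1]` on cohomology. -/
def cohomologyToTrunc (N m : ℕ) (q : ℤ) :
    H C.F C.d q →ₗ[S] H (C.truncF N) (C.truncD N) q :=
  Submodule.liftQ _ (C.cocyclesToTrunc N m q) fun z hz => by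
    rw [LinearMap.mem_ker]
    refine (congrArg _ (cls_eq_zero_iff.2 ?_)).trans (smul_zero _)
    exact C.baseChange_mem_coboundaries N hz

theorem cohomologyToTrunc_cls (N m : ℕ) (q : ℤ) (z : cocycles C.F C.d q) :
    C.cohomologyToTrunc N m q (cls C.F C.d q z) =
      t S N ^ m • cls (C.truncF N) (C.truncD N) q ⟨_, C.baseChange_mem_cocycles N z.2⟩ := rfl

theorem t_pow_smul_cls_eq_zero_iff (N m : ℕ) (q : ℤ)
    (z : cocycles (C.truncF N) (C.truncD N) q) :
    t S N ^ m • cls (C.truncF N) (C.truncD N) q z = 0 ↔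
      t S N ^ m • z.1 ∈ coboundaries (C.truncF N) (C.truncD N) q := by
  rw [← map_smul, cls_eq_zero_iff]
  rfl

/-- The t^m-coefficient of a cochain bounding t^m z bounds z. -/
theorem cohomologyToTrunc_injective {N m : ℕ} (hm : m < N) (q : ℤ) :
    Function.Injective (C.cohomologyToTrunc N m q) := by
  rw [injective_iff_map_eq_zero]
  intro c hc
  obtain ⟨z, rfl⟩ := cls_surjective _ _ _ c
  rw [cohomologyToTrunc_cls, t_pow_smul_cls_eq_zero_iff, ← evalEnd_monomial] at hc
  have := C.coeff_mem_coboundaries hc hm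
  rw [Polynomial.coeff_monomial_same] at this
  exact cls_eq_zero_iff.2 this

theorem map_HDeg_cohomologyToTrunc (i : ℕ) (q e : ℤ) :
    (HDeg C.F C.gr C.d q e).map (C.cohomologyToTrunc (i + 1) i q).toAddMonoidHom =
      (Ideal.span {t S (i + 1) ^ i} • (⊤ : Submodule (TruncPoly S (i + 1))
        (H (C.truncF (i + 1)) (C.truncD (i + 1)) q))).toAddSubgroup ⊓
      HDeg (C.truncF (i + 1)) (C.truncGr (i + 1)) (C.truncD (i + 1)) q e := by
  apply le_antisymm
  · rintro _ ⟨_, ⟨z, hz, rfl⟩, rfl⟩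
    refine ⟨?_, ⟨t S (i + 1) ^ i • ⟨_, C.baseChange_mem_cocycles (i + 1) z.2⟩, fun n k w hw => ?_,
      map_smul (cls (C.truncF (i + 1)) (C.truncD (i + 1)) q) _ _⟩⟩
    · change t S (i + 1) ^ i • cls (C.truncF (i + 1)) (C.truncD (i + 1)) q _ ∈
        Ideal.span {t S (i + 1) ^ i} • (⊤ : Submodule (TruncPoly S (i + 1))
          (H (C.truncF (i + 1)) (C.truncD (i + 1)) q))
      exact Submodule.smul_mem_smul (Ideal.mem_span_singleton_self _) Submodule.mem_top
    · exact C.t_pow_smul_mem_truncGr _ _ (C.isHomog_baseChange hz _ _ _ _ hw)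
  · rintro c ⟨hc, ⟨⟨Z, hZ⟩, hZh, rfl⟩⟩
    replace hc : cls (C.truncF (i + 1)) (C.truncD (i + 1)) q ⟨Z, hZ⟩ ∈
      Ideal.span {t S (i + 1) ^ i} • (⊤ : Submodule (TruncPoly S (i + 1))
        (H (C.truncF (i + 1)) (C.truncD (i + 1)) q)) := hc
    rw [Submodule.ideal_span_singleton_smul] at hc
    obtain ⟨c', -, hc'⟩ := hc
    obtain ⟨⟨W, hW⟩, rfl⟩ := cls_surjective _ _ _ c'
    obtain ⟨r, rfl⟩ := evalEnd_surjective _ Z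
    obtain ⟨p, rfl⟩ := evalEnd_surjective _ W
    have hr := C.evalEnd_mem_cocycles_iff.1 hZ i (by omega)
    have hp := C.evalEnd_mem_cocycles_iff.1 hW 0 (by omega)
    refine ⟨cls C.F C.d q ⟨_, hr⟩, ⟨_, C.isHomog_of_evalEnd hZh (by omega), rfl⟩, ?_⟩
    -- The homogeneous cocycle represents t^i times the class of a second cocycle. Comparing
    -- t^i-coefficients, its own t^i-coefficient is cohomologous to the constant term of the second
    -- one; only that constant term survives multiplication by t^i.
    have key : cls C.F C.d q ⟨_, hr⟩ = cls C.F C.d q ⟨_, hp⟩ := by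
      rw [cls_eq_iff]
      have h1 : evalEnd S T (i + 1) (r - Polynomial.X ^ i * p) ∈
          coboundaries (C.truncF (i + 1)) (C.truncD (i + 1)) q := by
        have : cls (C.truncF (i + 1)) (C.truncD (i + 1)) q (t S (i + 1) ^ i • ⟨_, hW⟩) =
          cls (C.truncF (i + 1)) (C.truncD (i + 1)) q ⟨_, hZ⟩ := hc'
        have := cls_eq_iff.1 this.symm
        rw [map_sub, ← evalEnd_t_pow_smul]
        exact this
      have := C.coeff_mem_coboundaries h1 (m := i) (by omega)
      rwa [Polynomial.coeff_sub, Polynomial.coeff_X_pow_mul', if_pos le_rfl, Nat.sub_self] at this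
    change C.cohomologyToTrunc (i + 1) i q (cls C.F C.d q ⟨_, hr⟩) = _
    rw [key, cohomologyToTrunc_cls, ← hc']
    change _ = t S (i + 1) ^ i • cls (C.truncF (i + 1)) (C.truncD (i + 1)) q ⟨_, hW⟩
    rw [← map_smul, ← map_smul]
    congr 1
    refine Subtype.ext ?_
    change t S (i + 1) ^ i • (p.coeff 0).baseChange _ = t S (i + 1) ^ i • evalEnd S T (i + 1) p
    rw [evalEnd_t_pow_smul, ← evalEnd_monomial, evalEnd_eq_iff]
    intro m hm
    rw [Polynomial.coeff_X_pow_mul', Polynomial.coeff_monomial]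
    by_cases h : i = m
    · subst h
      simp
    · rw [if_neg h, if_neg (by omega)]

end GradedFreeComplex

/-! ### Ext from a projective resolution of modules -/

section Ext

open CategoryTheory CategoryTheory.Abelian CochainComplex.HomComplex

/-- There are no coboundaries in degree 0: a bounding map would start from the term in cohomological
degree 1, which is zero. -/
theorem CategoryTheory.ProjectiveResolution.extMk_zero_eq_zero_iff {A : Type*} [Category A]
    [Abelian A] [HasExt A] {X Y : A} (R : ProjectiveResolution X) (f : R.complex.X 0 ⟶ Y)
    (hf : R.complex.d 1 0 ≫ f = 0) : R.extMk f 1 rfl hf = 0 ↔ f = 0 := by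
  constructor
  · rw [← R.extEquivCohomologyClass.apply_eq_iff_eq,
      R.extEquivCohomologyClass_extMk, R.extEquivCohomologyClass_zero,
      CohomologyClass.mk_eq_zero_iff,
      Cocycle.toSingleMk_mem_coboundaries_iff _ _ _ _ _ 1 (by lia)]
    rintro ⟨g, hg⟩
    rw [(R.cochainComplex.isZero_of_isStrictlyLE 0 1 (by simp)).eq_of_src g 0,
      Limits.comp_zero] at hg
    rw [← cancel_epi (R.cochainComplexXIso (-(0 : ℕ)) 0 rfl).hom, Limits.comp_zero]
    exact hg.symm
  · rintro rfl
    simp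

theorem CategoryTheory.ProjectiveResolution.smul_extMk {R : Type*} [Ring R] {A : Type*}
    [Category A] [Abelian A] [Linear R A] [HasExt A] {X Y : A} (P : ProjectiveResolution X) {n : ℕ}
    (r : R) (f : P.complex.X n ⟶ Y) (m : ℕ) (hm : n + 1 = m) (hf : P.complex.d m n ≫ f = 0) :
    r • P.extMk f m hm hf = P.extMk (r • f) m hm (by simp [hf]) := by
  rw [Ext.smul_eq_comp_mk₀, P.extMk_comp_mk₀]
  congr 1
  simp

variable {S : Type u} [CommRing S] {P : ℕ → Type u} [∀ n, AddCommGroup (P n)]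
  [∀ n, Module S (P n)] {M N : Type u} [AddCommGroup M]
  [Module S M] [AddCommGroup N] [Module S N]

/-- The chain complex of modules given by a sequence of linear maps. -/
def moduleChainComplex (d : ∀ n, P (n + 1) →ₗ[S] P n)
    (hd : ∀ n, Function.Exact (d (n + 1)) (d n)) : ChainComplex (ModuleCat S) ℕ :=
  ChainComplex.of (fun n => ModuleCat.of S (P n)) (fun n => ModuleCat.ofHom (d n)) fun n => by
    rw [← ModuleCat.ofHom_comp, (hd n).linearMap_comp_eq_zero]
    rfl

theorem moduleChainComplex_d (d : ∀ n, P (n + 1) →ₗ[S] P n)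
    (hd : ∀ n, Function.Exact (d (n + 1)) (d n)) (n : ℕ) :
    (moduleChainComplex d hd).d (n + 1) n = ModuleCat.ofHom (d n) :=
  ChainComplex.of_d (fun n => ModuleCat.of S (P n)) (fun n => ModuleCat.ofHom (d n)) n

/-- The differentials of the chain complex equal the given maps only propositionally; exactness is
transported along these equalities. -/
theorem exact_moduleCat_mk {X Y Z : ModuleCat.{u} S} {f f' : X ⟶ Y} {g g' : Y ⟶ Z} (w : f ≫ g = 0)
    (hf : f = f') (hg : g = g') (h : Function.Exact f' g') : (ShortComplex.mk f g w).Exact := by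
  subst hf hg
  exact ModuleCat.shortComplex_exact _ h

theorem epi_moduleCat {X Y : ModuleCat.{u} S} {f f' : X ⟶ Y} (hf : f = f')
    (h : Function.Surjective f') : Epi f := by
  subst hf
  exact (ModuleCat.epi_iff_surjective _).2 h

/-- The projective resolution given by an exact sequence of projective modules. -/
def projectiveResolutionOfExact (d : ∀ n, P (n + 1) →ₗ[S] P n) (ε : P 0 →ₗ[S] M)
    (hd : ∀ n, Function.Exact (d (n + 1)) (d n)) (h0 : Function.Exact (d 0) ε)
    (hε : Function.Surjective ε) [∀ n, Module.Projective S (P n)] :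
    ProjectiveResolution (ModuleCat.of S M) where
  complex := moduleChainComplex d hd
  projective n := (IsProjective.iff_projective (R := S) (P n)).1 inferInstance
  π := (ChainComplex.toSingle₀Equiv _ _).symm ⟨ModuleCat.ofHom ε, by
    rw [moduleChainComplex_d]
    exact (ModuleCat.ofHom_comp _ _).symm.trans (by rw [h0.linearMap_comp_eq_zero]; rfl)⟩
  quasiIso := ⟨fun m => by
    cases m with
    | zero =>
      rw [ChainComplex.quasiIsoAt₀_iff, ShortComplex.quasiIso_iff_of_zeros' _ rfl rfl rfl]
      constructor
      · exact exact_moduleCat_mk _ (moduleChainComplex_d d hd 0)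
          (ChainComplex.toSingle₀Equiv_symm_apply_f_zero _ _) h0
      · exact epi_moduleCat (ChainComplex.toSingle₀Equiv_symm_apply_f_zero _ _) hε
    | succ m =>
      rw [quasiIsoAt_iff_exactAt' (hL := ChainComplex.exactAt_succ_single_obj ..),
        HomologicalComplex.exactAt_iff' _ (m + 2) (m + 1) m (by simp) (by simp)]
      exact exact_moduleCat_mk _ (moduleChainComplex_d d hd (m + 1)) (moduleChainComplex_d d hd m)
        (hd m)⟩

/-- The coboundaries of degree `p` in the complex of linear maps from a chain complex to `N`. -/
def homCoboundaries (N : Type u) [AddCommGroup N] [Module S N] (d : ∀ n, P (n + 1) →ₗ[S] P n) :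
    ∀ p, Submodule S (P p →ₗ[S] N)
  | 0 => ⊥
  | p + 1 => LinearMap.range (LinearMap.lcomp S N (d p))

/-- `Ext` is computed by a projective resolution. -/
theorem exists_linearMap_ext [∀ n, Module.Projective S (P n)] (d : ∀ n, P (n + 1) →ₗ[S] P n)
    (ε : P 0 →ₗ[S] M) (hd : ∀ n, Function.Exact (d (n + 1)) (d n)) (h0 : Function.Exact (d 0) ε)
    (hε : Function.Surjective ε) (p : ℕ) :
    ∃ Θ : LinearMap.ker (LinearMap.lcomp S N (d p)) →ₗ[S]
        Ext (ModuleCat.of S M) (ModuleCat.of S N) p,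
      Function.Surjective Θ ∧ ∀ g, Θ g = 0 ↔ g.1 ∈ homCoboundaries N d p := by
  let R := projectiveResolutionOfExact d ε hd h0 hε
  have hR : ∀ n, R.complex.d (n + 1) n = ModuleCat.ofHom (d n) := moduleChainComplex_d d hd
  have hcomp : ∀ {n : ℕ} (g : P n →ₗ[S] N), R.complex.d (n + 1) n ≫
      (ModuleCat.ofHom g : R.complex.X n ⟶ ModuleCat.of S N) =
      ModuleCat.ofHom (LinearMap.lcomp S N (d n) g) := fun {n} g => by
    rw [hR]
    rfl
  have hker : ∀ g : LinearMap.ker (LinearMap.lcomp S N (d p)), R.complex.d (p + 1) p ≫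
      (ModuleCat.ofHom g.1 : R.complex.X p ⟶ ModuleCat.of S N) = 0 := fun g => by
    rw [hcomp, LinearMap.mem_ker.1 g.2]
    rfl
  refine ⟨⟨⟨fun g => R.extMk (ModuleCat.ofHom g.1) (p + 1) rfl (hker g), fun g h => ?_⟩,
    fun c g => ?_⟩, fun α => ?_, fun g => ?_⟩
  · exact (R.add_extMk _ _ _ rfl (hker g) (hker h)).symm
  · exact (R.smul_extMk c _ _ rfl (hker g)).symm
  · obtain ⟨f, hf, rfl⟩ := R.extMk_surjective α (p + 1) rfl
    exact ⟨⟨f.hom, congrArg ModuleCat.Hom.hom ((hcomp f.hom).symm.trans hf)⟩, rfl⟩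
  · cases p with
    | zero =>
      refine (R.extMk_zero_eq_zero_iff _ (hker g)).trans ⟨fun h => ?_, fun h => ?_⟩
      · exact congrArg ModuleCat.Hom.hom h
      · rw [show g.1 = 0 from h]
        rfl
    | succ p =>
      refine (R.extMk_eq_zero_iff _ _ rfl (hker g) p rfl).trans ⟨?_, ?_⟩
      · rintro ⟨f, hf⟩
        exact ⟨f.hom, congrArg ModuleCat.Hom.hom ((hcomp f.hom).symm.trans hf)⟩
      · rintro ⟨f, hf⟩
        exact ⟨ModuleCat.ofHom f, (hcomp f).trans (by rw [hf])⟩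

end Ext

/-! ### The endomorphism complex of a resolution and Ext(M, M) -/

namespace GradedFreeComplex

open EndComplex

variable {S : Type u} [CommRing S] {𝒜 : ℤ → AddSubgroup S}
  {T : Type u} [AddCommGroup T] [Module S T] {C : GradedFreeComplex 𝒜 T}

theorem d_d (x : T) : C.d (C.d x) = 0 := LinearMap.congr_fun C.d_sq x

theorem eq_zero_of_mem_F_neg {n : ℤ} (hn : n < 0) {x : T} (hx : x ∈ C.F n) : x = 0 := by
  rwa [C.bounded n (Or.inl hn), Submodule.mem_bot] at hx

theorem diff_mem_cochains {q : ℤ} {φ : Module.End S T} (hφ : φ ∈ cochains C.F q) :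
    diff C.d q φ ∈ cochains C.F (q + 1) := by
  rw [diff_apply]
  refine sub_mem ?_ (zsmul_mem (mul_mem_cochains hφ C.d_mem_cochains) _)
  rw [add_comm]
  exact mul_mem_cochains C.d_mem_cochains hφ

theorem negOnePow_mul_self (q : ℤ) : (q.negOnePow : ℤ) * q.negOnePow = 1 := by
  rw [← Units.val_mul, ← Int.negOnePow_add, ← two_mul, Int.negOnePow_two_mul, Units.val_one]

theorem diff_diff (q : ℤ) (φ : Module.End S T) : diff C.d (q + 1) (diff C.d q φ) = 0 := by
  rw [diff_apply, diff_apply, mul_sub, ← mul_assoc, C.d_sq, mul_smul_comm, sub_mul, smul_mul_assoc,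
    mul_assoc φ, C.d_sq, Int.negOnePow_succ, mul_assoc]
  simp

theorem update_mem_cochains {ι : Type} (B : C.AdaptedBasis ι) {q n : ℤ} {φ : Module.End S T}
    (hφ : φ ∈ cochains C.F q) {v : ι → T} (hv : ∀ i, B.h i = n → v i ∈ C.F (n - q)) :
    B.update n φ v ∈ cochains C.F q := by
  intro m x hx
  by_cases hm : m = n
  · subst hm
    induction x, hx using B.induction_F with
    | zero => simp
    | add x y _ _ hx hy => simpa using add_mem hx hy
    | smul c x _ hx => simpa using Submodule.smul_mem _ _ hx
    | basis i _ hi =>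
      rw [B.update_basis _ _ hi]
      exact hv i hi
  · rw [B.update_of_ne _ _ hm hx]
    exact hφ m x hx

section Resolution

variable {M : Type u} [AddCommGroup M] [Module S M]

/-- The augmentation `F 0 → M`, extended by zero to the total module. -/
def AdaptedBasis.augmentation {ι : Type} (B : C.AdaptedBasis ι) (ε : C.F 0 →ₗ[S] M) : T →ₗ[S] M :=
  ε ∘ₗ (B.pr 0).codRestrict (C.F 0) (B.pr_mem 0)

variable {gM : ℤ → AddSubgroup M} {ε : C.F 0 →ₗ[S] M} {ι : Type} (B : C.AdaptedBasis ι)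

theorem AdaptedBasis.augmentation_of_mem {x : T} (hx : x ∈ C.F 0) :
    B.augmentation ε x = ε ⟨x, hx⟩ :=
  congrArg ε (Subtype.ext (B.pr_of_mem hx))

namespace IsResolution

theorem augmentation_d (hε : C.IsResolution gM ε) (x : T) : B.augmentation ε (C.d x) = 0 := by
  suffices B.augmentation ε ∘ₗ C.d = 0 from LinearMap.congr_fun this x
  refine B.ext_F fun n _ _ x hx => ?_
  rw [LinearMap.comp_apply, LinearMap.zero_apply]
  have hd := C.d_mem n x hx
  by_cases hn : n = 1
  · subst hn
    rw [B.augmentation_of_mem hd]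
    exact (hε.exact_zero _).2 ⟨x, hx, rfl⟩
  · have : B.pr 0 (C.d x) = 0 := B.pr_of_mem_ne hd (by omega)
    refine (congrArg ε (Subtype.ext this)).trans (map_zero _)

theorem exists_d_eq (hε : C.IsResolution gM ε) {n : ℤ} {x : T} (hx : x ∈ C.F n) (h0 : n = 0 → B.augmentation ε x = 0)
    (hd : 0 < n → C.d x = 0) : ∃ y ∈ C.F (n + 1), C.d y = x := by
  rcases lt_trichotomy n 0 with hn | rfl | hn
  · exact ⟨0, zero_mem _, by rw [eq_zero_of_mem_F_neg hn hx, map_zero]⟩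
  · have := h0 rfl
    rw [B.augmentation_of_mem hx] at this
    exact (hε.exact_zero _).1 this
  · exact hε.exact_pos n hn x hx (hd hn)

/-- A cocycle that vanishes after augmentation is null-homotopic. -/
theorem exists_diff_eq (hε : C.IsResolution gM ε) {q : ℤ} {φ : Module.End S T}
    (hφ : φ ∈ cocycles C.F C.d q)
    (h0 : ∀ x ∈ C.F q, B.augmentation ε (φ x) = 0) :
    ∃ w ∈ cochains C.F (q - 1), diff C.d (q - 1) w = φ ∧ ∀ x ∈ C.F (q - 1), w x = 0 := by
  obtain ⟨hφc, hφd⟩ := mem_cocycles.1 hφ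
  set s : ℤ := ((q - 1).negOnePow : ℤ) with hs
  have hs' : (q.negOnePow : ℤ) = -s := by rw [hs, Int.negOnePow_sub]; simp
  have hφd' : ∀ x, C.d (φ x) = -(s • φ (C.d x)) := fun x => by
    have := LinearMap.congr_fun hφd x
    rw [diff_apply, hs', neg_smul, sub_neg_eq_add] at this
    exact eq_neg_of_add_eq_zero_left this
  -- The homotopy w is built on F 0, F 1, … by choosing values on basis vectors. Its vanishing on F
  -- (q - 1), the component it maps to F 0, is carried along because the correction of a lifted
  -- cochain must not change its augmentation.
  have key : ∀ n : ℕ, ∃ w ∈ cochains C.F (q - 1), (∀ x ∈ C.F (q - 1), w x = 0) ∧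
      ∀ m : ℤ, m < n → ∀ x ∈ C.F m, C.d (w x) - s • w (C.d x) = φ x := by
    intro n
    induction n with
    | zero =>
      refine ⟨0, zero_mem _, fun x _ => rfl, fun m hm x hx => ?_⟩
      rw [eq_zero_of_mem_F_neg (by exact_mod_cast hm) hx]
      simp
    | succ n ih =>
      obtain ⟨w, hw, hw0, hwd⟩ := ih
      have hex : ∀ i, ∃ v, B.h i = n → v ∈ C.F (n - (q - 1)) ∧
          C.d v = φ (B.b i) + s • w (C.d (B.b i)) ∧ ((n : ℤ) = q - 1 → v = 0) := by
        intro i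
        by_cases hi : B.h i = n
        · have hb : B.b i ∈ C.F n := hi ▸ B.basis_mem_F i
          have hdb := C.d_mem _ _ hb
          have hy : φ (B.b i) + s • w (C.d (B.b i)) ∈ C.F (n - q) := by
            refine add_mem (hφc _ _ hb) (zsmul_mem ?_ _)
            have := hw _ _ hdb
            rwa [show (n : ℤ) - 1 - (q - 1) = n - q by ring] at this
          -- For n = q - 1 the element to be bounded lies in F (-1) = 0, so v = 0 is allowed. For n
          -- = q it lies in F 0, where exactness requires its augmentation to vanish; otherwise it
          -- has to be a d-cycle.
          by_cases hn : (n : ℤ) = q - 1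
          · refine ⟨0, fun _ => ⟨zero_mem _, ?_, fun _ => rfl⟩⟩
            rw [eq_zero_of_mem_F_neg (by omega) hy, map_zero]
          · obtain ⟨v, hv, hvd⟩ := hε.exists_d_eq B hy
              (fun h => by
                have hnq : (n : ℤ) = q := by omega
                rw [hnq] at hb hdb
                rw [hw0 _ hdb, smul_zero, add_zero, h0 _ hb])
              (fun _ => by
                have := hwd (n - 1) (by omega) _ hdb
                rw [d_d, map_zero, smul_zero, sub_zero] at this
                rw [map_add, map_zsmul, this, hφd', neg_add_cancel])
            rw [show (n : ℤ) - q + 1 = n - (q - 1) by ring] at hv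
            exact ⟨v, fun _ => ⟨hv, hvd, fun h => absurd h hn⟩⟩
        · exact ⟨0, fun h => absurd h hi⟩
      choose v hv using hex
      refine ⟨B.update n w v, update_mem_cochains B hw fun i hi => (hv i hi).1, fun x hx => ?_,
        fun m hm x hx => ?_⟩
      · by_cases hn : q - 1 = n
        · induction x, hx using B.induction_F with
          | zero => simp
          | add x y _ _ hx hy => rw [map_add, hx, hy, add_zero]
          | smul c x _ hx => rw [map_smul, hx, smul_zero]
          | basis i _ hi =>
            rw [B.update_basis _ _ (hi.trans hn)]
            exact (hv i (hi.trans hn)).2.2 hn.symm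
        · rw [B.update_of_ne _ _ hn hx]
          exact hw0 x hx
      · have hdx := C.d_mem m x hx
        rw [B.update_of_ne w v (by push_cast at hm; omega) hdx]
        by_cases hmn : m = n
        · subst hmn
          clear hdx hm
          induction x, hx using B.induction_F with
          | zero => simp
          | add x y _ _ hx hy =>
            rw [map_add φ, ← hx, ← hy]
            simp only [map_add, smul_add]
            abel
          | smul c x _ hx =>
            rw [map_smul φ, ← hx]
            simp only [map_smul, smul_sub, smul_comm c s]
          | basis i _ hi =>
            rw [B.update_basis _ _ hi, (hv i hi).2.1, add_sub_cancel_right]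
        · rw [B.update_of_ne w v hmn hx]
          exact hwd m (by push_cast at hm; omega) x hx
  obtain ⟨w, hw, hw0, hwd⟩ := key (C.len + 1)
  exact ⟨w, hw, B.ext_F fun n _ hn x hx => hwd n (by push_cast; omega) x hx, hw0⟩

theorem exists_cochain_lift (hε : C.IsResolution gM ε) {p : ℤ} (g : C.F p →ₗ[S] M) :
    ∃ φ ∈ cochains C.F p, ∀ x, B.augmentation ε (φ x.1) = g x := by
  have hex : ∀ i, ∃ v, ∀ hi : B.b i ∈ C.F p, v ∈ C.F 0 ∧ B.augmentation ε v = g ⟨B.b i, hi⟩ := by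
    intro i
    by_cases hi : B.b i ∈ C.F p
    · obtain ⟨v, hv⟩ := hε.surjective (g ⟨B.b i, hi⟩)
      exact ⟨v, fun _ => ⟨v.2, (B.augmentation_of_mem v.2).trans hv⟩⟩
    · exact ⟨0, fun h => absurd h hi⟩
  choose v hv using hex
  refine ⟨B.update p 0 v, update_mem_cochains B (zero_mem _) fun i hi => ?_, fun ⟨x, hx⟩ => ?_⟩
  · rw [sub_self]
    exact (hv i (hi ▸ B.basis_mem_F i)).1
  · induction x, hx using B.induction_F with
    | zero => exact (by simp : _ = (0 : M)).trans (map_zero g).symm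
    | add x y hx' hy' hx hy =>
      rw [map_add, map_add, hx, hy, ← map_add]
      rfl
    | smul c x hx' hx =>
      rw [map_smul, map_smul, hx, ← map_smul]
      rfl
    | basis i hi' hi =>
      rw [B.update_basis _ _ hi]
      exact (hv i hi').2

/-- The differentials of the complex as maps between its components. -/
def _root_.GradedFreeComplex.dComponent (C : GradedFreeComplex 𝒜 T) (n : ℕ) :
    C.F ((n + 1 : ℕ) : ℤ) →ₗ[S] C.F (n : ℤ) :=
  C.d.restrict fun x hx => by simpa using C.d_mem _ x hx

/-- The map from cocycles of degree `p` to cocycles with values in `M`. -/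
def cocyclesToHom (hε : C.IsResolution gM ε) (p : ℕ) : cocycles C.F C.d p →ₗ[S]
    LinearMap.ker (LinearMap.lcomp S M (C.dComponent p)) where
  toFun z := ⟨B.augmentation ε ∘ₗ z.1 ∘ₗ (C.F (p : ℤ)).subtype, by
    rw [LinearMap.mem_ker]
    refine LinearMap.ext fun x => ?_
    change B.augmentation ε (z.1 (C.d x.1)) = 0
    have := LinearMap.congr_fun (mem_cocycles.1 z.2).2 x.1
    rw [diff_apply, LinearMap.sub_apply, LinearMap.zero_apply, sub_eq_zero, LinearMap.smul_apply,
      Module.End.mul_apply, Module.End.mul_apply] at this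
    have h := congrArg (B.augmentation ε) this
    rw [hε.augmentation_d, map_zsmul] at h
    have h2 := congrArg (((p : ℤ).negOnePow : ℤ) • ·) h
    simp only [smul_zero, smul_smul, negOnePow_mul_self, one_smul] at h2
    exact h2.symm⟩
  map_add' z w := Subtype.ext (LinearMap.ext fun x => map_add (B.augmentation ε) _ _)
  map_smul' c z := Subtype.ext (LinearMap.ext fun x => map_smul (B.augmentation ε) _ _)

theorem cocyclesToHom_apply (hε : C.IsResolution gM ε) (p : ℕ) (z : cocycles C.F C.d p) (x : C.F (p : ℤ)) :
    (cocyclesToHom B hε p z).1 x = B.augmentation ε (z.1 x.1) := rfl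

theorem augmentation_diff_apply (hε : C.IsResolution gM ε) (q : ℤ) (φ : Module.End S T) (x : T) :
    B.augmentation ε (diff C.d q φ x) =
      -((q.negOnePow : ℤ) • B.augmentation ε (φ (C.d x))) := by
  rw [diff_apply, LinearMap.sub_apply, map_sub, Module.End.mul_apply, hε.augmentation_d, zero_sub,
    LinearMap.smul_apply, map_zsmul]
  rfl

/-- Lift g to a cochain φ. Its coboundary dies under the augmentation because g kills boundaries, so
it equals the coboundary of some w that vanishes on F p. Then φ - w is a cocycle with the same
augmentation as φ. -/
theorem cocyclesToHom_surjective (hε : C.IsResolution gM ε) (p : ℕ) : Function.Surjective (cocyclesToHom B hε p) := by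
  rintro ⟨g, hg⟩
  obtain ⟨φ, hφ, hφg⟩ := hε.exists_cochain_lift B g
  have hg' : ∀ x, g (C.dComponent p x) = 0 := fun x => LinearMap.congr_fun hg x
  obtain ⟨w, hw, hwd, hw0⟩ := hε.exists_diff_eq B (q := p + 1) (φ := diff C.d p φ)
    (mem_cocycles.2 ⟨diff_mem_cochains hφ, diff_diff _ _⟩) fun x hx => by
      rw [hε.augmentation_diff_apply B]
      have := (hφg (C.dComponent p ⟨x, by exact_mod_cast hx⟩)).trans (hg' _)
      change B.augmentation ε (φ (C.d x)) = 0 at this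
      rw [this, smul_zero, neg_zero]
  rw [add_sub_cancel_right] at hw hwd hw0
  refine ⟨⟨φ - w, mem_cocycles.2 ⟨sub_mem hφ hw, by rw [map_sub, hwd, sub_self]⟩⟩,
    Subtype.ext (LinearMap.ext fun x => ?_)⟩
  rw [cocyclesToHom_apply, LinearMap.sub_apply, hw0 _ x.2, sub_zero, hφg]

/-- If ψ ∘ d is the augmentation of z, lift ψ to a cochain φ; then z corrected by ± the coboundary
of φ has zero augmentation and bounds. In degree 0 there is no ψ and z bounds directly. Conversely,
the augmentation of a coboundary factors through d. -/
theorem cocyclesToHom_mem_iff (hε : C.IsResolution gM ε) (p : ℕ) (z : cocycles C.F C.d p) :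
    (cocyclesToHom B hε p z).1 ∈ homCoboundaries (P := fun n : ℕ => C.F (n : ℤ)) M C.dComponent p ↔
      z.1 ∈ coboundaries C.F C.d p := by
  rw [mem_coboundaries (q := p - 1) (by ring)]
  constructor
  · intro h
    cases p with
    | zero =>
      obtain ⟨w, hw, hwd, -⟩ := hε.exists_diff_eq B z.2 fun x hx =>
        LinearMap.congr_fun (show (cocyclesToHom B hε 0 z).1 = 0 from h) ⟨x, hx⟩
      exact ⟨w, hw, hwd⟩
    | succ p =>
      obtain ⟨ψ, hψ⟩ := h
      have hψ' : ∀ x : C.F ((p + 1 : ℕ) : ℤ), ψ (C.dComponent p x) = B.augmentation ε (z.1 x.1) :=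
        fun x => LinearMap.congr_fun hψ x
      obtain ⟨φ, hφ, hφψ⟩ := hε.exists_cochain_lift B ψ
      set s : ℤ := ((p : ℤ).negOnePow : ℤ) with hs
      have hc : ((p + 1 : ℕ) : ℤ) = p + 1 := by push_cast; rfl
      have hdφ : diff C.d p φ ∈ cocycles C.F C.d ((p + 1 : ℕ) : ℤ) := by
        rw [hc]
        exact mem_cocycles.2 ⟨diff_mem_cochains hφ, diff_diff _ _⟩
      obtain ⟨w, hw, hwd, -⟩ := hε.exists_diff_eq B (add_mem z.2 (zsmul_mem hdφ s))
        fun x hx => by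
          have h1 := hψ' ⟨x, hx⟩
          rw [← hφψ] at h1
          change B.augmentation ε (φ (C.d x)) = B.augmentation ε (z.1 x) at h1
          rw [LinearMap.add_apply, LinearMap.smul_apply, map_add, map_zsmul,
            hε.augmentation_diff_apply B, h1, smul_neg, smul_smul, negOnePow_mul_self, one_smul,
            add_neg_cancel]
      have hc' : ((p + 1 : ℕ) : ℤ) - 1 = p := by omega
      rw [hc'] at hw hwd ⊢
      refine ⟨w - s • φ, sub_mem hw (zsmul_mem hφ s), ?_⟩
      rw [map_sub, map_zsmul, hwd, add_sub_cancel_right]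
  · rintro ⟨w, hw, hwd⟩
    have h1 : ∀ x, (cocyclesToHom B hε p z).1 x =
        -((((p : ℤ) - 1).negOnePow : ℤ) • B.augmentation ε (w (C.d x.1))) := fun x => by
      rw [cocyclesToHom_apply, ← hwd, hε.augmentation_diff_apply B]
    cases p with
    | zero =>
      change (cocyclesToHom B hε 0 z).1 = 0
      refine LinearMap.ext fun x => ?_
      rw [h1, eq_zero_of_mem_F_neg (by simp) (C.d_mem _ _ x.2)]
      simp
    | succ p =>
      refine ⟨-(((((p + 1 : ℕ) : ℤ) - 1).negOnePow : ℤ) •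
        B.augmentation ε ∘ₗ w ∘ₗ (C.F (p : ℤ)).subtype), LinearMap.ext fun x => ?_⟩
      rw [h1]
      rfl

/-- The cohomology of the endomorphism complex of a resolution of `M` is `Ext (M, M)`. -/
theorem nonempty_linearEquiv_ext (hε : C.IsResolution gM ε) (p : ℕ) : Nonempty (H C.F C.d p ≃ₗ[S]
    CategoryTheory.Abelian.Ext (ModuleCat.of S M) (ModuleCat.of S M) p) := by
  obtain ⟨ι, ⟨B⟩⟩ := C.exists_adaptedBasis
  have hproj : ∀ n : ℕ, Module.Projective S (C.F (n : ℤ)) := fun n => by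
    obtain ⟨r, e, b, -⟩ := C.free n
    exact Module.Projective.of_basis b
  have hd : ∀ n : ℕ, Function.Exact (C.dComponent (n + 1)) (C.dComponent n) := by
    rintro n ⟨x, hx⟩
    constructor
    · intro h
      obtain ⟨y, hy, hyx⟩ := hε.exact_pos _ (by positivity) x hx (congrArg Subtype.val h)
      exact ⟨⟨y, by exact_mod_cast hy⟩, Subtype.ext hyx⟩
    · rintro ⟨y, hy⟩
      rw [← hy]
      exact Subtype.ext (d_d y.1)
  have h0 : Function.Exact (C.dComponent 0) ε := by
    intro x
    rw [hε.exact_zero]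
    constructor
    · rintro ⟨y, hy, hyx⟩
      exact ⟨⟨y, by exact_mod_cast hy⟩, Subtype.ext hyx⟩
    · rintro ⟨y, rfl⟩
      exact ⟨y.1, by exact_mod_cast y.2, rfl⟩
  obtain ⟨Θ, hΘ, hΘ0⟩ := exists_linearMap_ext (P := fun n : ℕ => C.F (n : ℤ)) (N := M)
    C.dComponent ε hd h0 hε.surjective p
  have hker : (coboundaries C.F C.d p).submoduleOf (cocycles C.F C.d p) =
      LinearMap.ker (Θ ∘ₗ cocyclesToHom B hε p) := by
    ext z
    rw [LinearMap.mem_ker, LinearMap.comp_apply, hΘ0, hε.cocyclesToHom_mem_iff B]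
    rfl
  exact ⟨(Submodule.quotEquivOfEq _ _ hker).trans (LinearMap.quotKerEquivOfSurjective _
    (hΘ.comp (hε.cocyclesToHom_surjective B p)))⟩

end IsResolution

end Resolution

end GradedFreeComplex

/-! ### Flags mapping quasi-isomorphically to a differential module -/

namespace GradedFreeComplex

open EndComplex

variable {S : Type u} [CommRing S] {𝒜 : ℤ → AddSubgroup S}
  {T : Type u} [AddCommGroup T] [Module S T] {C : GradedFreeComplex 𝒜 T}

variable (C) in
/-- The sum of the components of homological degree less than `n`. -/
def lowerF (n : ℤ) : Submodule S T := ⨆ m : {m : ℤ // m < n}, C.F m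

theorem mem_lowerF {m n : ℤ} (h : m < n) {x : T} (hx : x ∈ C.F m) : x ∈ C.lowerF n :=
  Submodule.mem_iSup_of_mem (p := fun m : {m : ℤ // m < n} => C.F m) ⟨m, h⟩ hx

theorem lowerF_le {n : ℤ} {L : Submodule S T} (h : ∀ m < n, C.F m ≤ L) : C.lowerF n ≤ L :=
  iSup_le fun m => h m.1 m.2

theorem lowerF_mono {m n : ℤ} (h : m ≤ n) : C.lowerF m ≤ C.lowerF n :=
  lowerF_le fun _ hl _ hx => mem_lowerF (hl.trans_le h) hx

theorem eq_zero_of_mem_lowerF {n : ℤ} (hn : n ≤ 0) {x : T} (hx : x ∈ C.lowerF n) : x = 0 := by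
  have : C.lowerF n ≤ ⊥ := lowerF_le fun m hm x hx =>
    (Submodule.mem_bot S).2 (eq_zero_of_mem_F_neg (hm.trans_le hn) hx)
  exact (Submodule.mem_bot S).1 (this hx)

theorem homPart_mem_lowerF [GradedRing 𝒜] (a k n : ℤ) {x : T} (hx : x ∈ C.lowerF n) :
    homPart (foldGr C.gr a) k x ∈ C.lowerF n := by
  induction hx using Submodule.iSup_induction' with
  | mem m x hx => exact mem_lowerF m.2 (C.homPart_mem_F a k hx)
  | zero => simp
  | add x y _ _ hx hy => simpa using add_mem hx hy

namespace AdaptedBasis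

variable {ι : Type} (B : C.AdaptedBasis ι)

theorem lowerF_eq_top (B : C.AdaptedBasis ι) {n : ℤ} (hn : C.len < n) : C.lowerF n = ⊤ := by
  refine eq_top_iff.2 fun x _ => (B.mem_iSup_F _ x).2 fun i hi => ?_
  have := B.h_le i
  omega

theorem sub_pr_mem_lowerF {n : ℤ} {x : T} (hx : x ∈ C.lowerF (n + 1)) :
    x - B.pr n x ∈ C.lowerF n := by
  refine (B.mem_iSup_F _ _).2 fun i hi => ?_
  rw [map_sub, Finsupp.sub_apply, B.repr_pr]
  split_ifs with h
  · rw [sub_self]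
  · rw [(B.mem_iSup_F _ _).1 hx i (by omega), sub_zero]

theorem update_of_mem_lowerF {N : Type*} [AddCommGroup N] [Module S N] {n : ℤ} (f : T →ₗ[S] N)
    (v : ι → N) {x : T} (hx : x ∈ C.lowerF n) : B.update n f v x = f x := by
  have : C.lowerF n ≤ LinearMap.eqLocus (B.update n f v) f :=
    lowerF_le fun m hm x hx => B.update_of_ne f v hm.ne hx
  exact this hx

theorem mem_of_basis_mem [GradedRing 𝒜] (a s : ℤ) {N : Type*} [AddCommGroup N] [Module S N]
    {gN : ℤ → AddSubgroup N}
    (hN : ∀ j k : ℤ, ∀ c ∈ 𝒜 j, ∀ v ∈ gN k, c • v ∈ gN (k + j)) {f : T →ₗ[S] N}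
    (hf : ∀ i, f (B.b i) ∈ gN (B.e i - B.h i * a + s)) {k : ℤ} {x : T}
    (hx : x ∈ foldGr C.gr a k) : f x ∈ gN (k + s) := by
  rw [B.mem_foldGr] at hx
  rw [← B.b.linearCombination_repr x, Finsupp.linearCombination_apply, Finsupp.sum, map_sum]
  refine sum_mem fun i _ => ?_
  rw [map_smul]
  convert hN _ _ _ (hx i) _ (hf i) using 2
  ring

end AdaptedBasis

section DifferentialModule

variable {M : Type u} [AddCommGroup M] [Module S M] {gM : ℤ → AddSubgroup M}
  {ε : C.F 0 →ₗ[S] M} {ι : Type} (B : C.AdaptedBasis ι)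
  {D : Type u} [AddCommGroup D] [Module S D] {gD : ℤ → AddSubgroup D}
  {dD : Module.End S D}

/-- The endomorphism `E` of `F` and the map `f : F → D` have, on the components of homological
degree less than `n`, the properties of a free flag anchored on the complex and of a morphism of
differential modules that induces on `F 0` the augmentation to the homology of `D`. -/
structure IsPartialFlag (ε : C.F 0 →ₗ[S] M) (gD : ℤ → AddSubgroup D) (dD : Module.End S D)
    (κ : LinearMap.ker dD →ₗ[S] M) (a n : ℤ) (E : Module.End S T) (f : T →ₗ[S] D) : Prop where
  anchor : ∀ m < n, ∀ x ∈ C.F m, E x - C.d x ∈ C.lowerF (m - 1)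
  sq : ∀ m < n, ∀ x ∈ C.F m, E (E x) = 0
  comm : ∀ m < n, ∀ x ∈ C.F m, f (E x) = dD (f x)
  aug : 0 < n → ∀ x : C.F 0, ∃ h : f x.1 ∈ LinearMap.ker dD, κ ⟨f x.1, h⟩ = ε x
  homog : ∀ k, ∀ x ∈ foldGr C.gr a k, E x ∈ foldGr C.gr a (k + a)
  map_homog : ∀ k, ∀ x ∈ foldGr C.gr a k, f x ∈ gD k

namespace IsPartialFlag

variable {κ : LinearMap.ker dD →ₗ[S] M} {a n : ℤ} {E : Module.End S T} {f : T →ₗ[S] D}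

theorem apply_mem_lowerF (h : C.IsPartialFlag ε gD dD κ a n E f) {m : ℤ} (hm : m ≤ n) {x : T}
    (hx : x ∈ C.lowerF m) : E x ∈ C.lowerF (m - 1) := by
  have : C.lowerF m ≤ (C.lowerF (m - 1)).comap E := by
    refine lowerF_le fun l hl x hx => ?_
    rw [Submodule.mem_comap, ← sub_add_cancel (E x) (C.d x)]
    exact add_mem (lowerF_mono (by omega) (h.anchor l (by omega) x hx))
      (mem_lowerF (by omega) (C.d_mem l x hx))
  exact this hx

theorem sq_of_mem_lowerF (h : C.IsPartialFlag ε gD dD κ a n E f) {x : T}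
    (hx : x ∈ C.lowerF n) : E (E x) = 0 := by
  have : C.lowerF n ≤ LinearMap.ker (E * E) := lowerF_le fun l hl x hx => h.sq l hl x hx
  exact this hx

theorem comm_of_mem_lowerF (h : C.IsPartialFlag ε gD dD κ a n E f) {x : T}
    (hx : x ∈ C.lowerF n) : f (E x) = dD (f x) := by
  have : C.lowerF n ≤ LinearMap.eqLocus (f ∘ₗ E) (dD ∘ₗ f) :=
    lowerF_le fun l hl x hx => h.comm l hl x hx
  exact this hx

/-- The mapping cone of a partial flag is acyclic in a range. -/
theorem exists_cone_boundary (h : C.IsPartialFlag ε gD dD κ a n E f) (hε : C.IsResolution gM ε)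
    (hκ : ∀ v, κ v = 0 ↔ ∃ u, dD u = v.1) (j : ℕ) (hj : j < n) {y : T} (hy : y ∈ C.lowerF j)
    {v : D} (hEy : E y = 0) (hfy : f y = dD v) :
    ∃ z ∈ C.lowerF (j + 1), ∃ w, E z = y ∧ f z - dD w = v := by
  obtain ⟨ι, ⟨B⟩⟩ := C.exists_adaptedBasis
  induction j generalizing y v with
  | zero =>
    have hy0 := eq_zero_of_mem_lowerF le_rfl hy
    subst hy0
    rw [map_zero] at hfy
    -- Here y = 0 and v is a cycle. Its homology class is the augmentation of some x in F 0, and f x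
    -- represents the same class.
    obtain ⟨x, hx⟩ := hε.surjective (κ ⟨v, hfy.symm⟩)
    obtain ⟨hfx, hfx'⟩ := h.aug hj x
    obtain ⟨w, hw⟩ := (hκ (⟨f x.1, hfx⟩ - ⟨v, hfy.symm⟩)).1 (by rw [map_sub, hfx', hx, sub_self])
    have hx' : x.1 ∈ C.lowerF 1 := mem_lowerF (by omega) x.2
    refine ⟨x.1, by simpa using hx', w, ?_, ?_⟩
    · exact eq_zero_of_mem_lowerF (by simp) (h.apply_mem_lowerF (by exact_mod_cast hj) hx')
    · rw [hw]
      exact sub_sub_cancel _ _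
  | succ j ih =>
    push_cast at hj hy
    have hjn : (j : ℤ) < n := by omega
    have hy' := B.sub_pr_mem_lowerF hy
    have htop := B.pr_mem j y
    -- The leading term of y is a d-cycle, because E y = 0 and E agrees with d up to lower terms. In
    -- F 0 its augmentation vanishes because f y is a boundary. So it equals d z₀, and subtracting
    -- the cone boundary of z₀ lowers the filtration.
    obtain ⟨z₀, hz₀, hdz₀⟩ := hε.exists_d_eq B htop
      (fun hj0 => by
        rw [hj0] at hy' htop ⊢
        have hyy := sub_eq_zero.1 (eq_zero_of_mem_lowerF le_rfl hy')
        rw [← hyy] at htop ⊢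
        obtain ⟨hk, hk'⟩ := h.aug (by omega) ⟨y, htop⟩
        rw [B.augmentation_of_mem htop, ← hk', hκ]
        exact ⟨v, hfy.symm⟩)
      (fun hj0 => by
        have h1 : E (y - B.pr j y) ∈ C.lowerF (j - 1) := h.apply_mem_lowerF hjn.le hy'
        have h2 := h.anchor j hjn _ htop
        have h3 := add_mem h1 h2
        rw [map_sub, hEy, zero_sub, neg_add_eq_sub, sub_sub_cancel_left, neg_mem_iff] at h3
        rw [← B.pr_of_mem (C.d_mem _ _ htop)]
        exact B.pr_of_mem_iSup h3 (by omega))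
    have hz₀' : z₀ ∈ C.lowerF n := mem_lowerF hj hz₀
    have h1 := h.anchor _ hj z₀ hz₀
    rw [add_sub_cancel_right, hdz₀] at h1
    obtain ⟨z, hz, w, hEz, hfz⟩ := ih hjn (y := y - E z₀) (v := v - f z₀)
      (by simpa using sub_mem hy' h1)
      (by rw [map_sub, hEy, h.sq_of_mem_lowerF hz₀', sub_zero])
      (by rw [map_sub, hfy, h.comm_of_mem_lowerF hz₀', map_sub])
    refine ⟨z₀ + z, add_mem (mem_lowerF ?_ hz₀) (lowerF_mono ?_ hz), w, ?_, ?_⟩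
    · push_cast
      omega
    · push_cast
      omega
    · rw [map_add, hEz, add_sub_cancel]
    · rw [map_add, add_sub_assoc, hfz, add_sub_cancel]

/-- The differential of an element of `F n` lifts to a cycle in the mapping cone of a partial
flag. -/
theorem exists_cone_cycle (h : C.IsPartialFlag ε gD dD κ a n E f) (hε : C.IsResolution gM ε)
    (hκ : ∀ v, κ v = 0 ↔ ∃ u, dD u = v.1) (hn : 0 < n) {b : T} (hb : b ∈ C.F n) :
    ∃ y v, y - C.d b ∈ C.lowerF (n - 1) ∧ E y = 0 ∧ f y = dD v := by
  obtain ⟨ι, ⟨B⟩⟩ := C.exists_adaptedBasis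
  have hdb := C.d_mem n b hb
  by_cases hn1 : n = 1
  · subst hn1
    rw [sub_self] at hdb ⊢
    obtain ⟨hk, hk'⟩ := h.aug hn ⟨_, hdb⟩
    obtain ⟨v, hv⟩ := (hκ _).1 (hk'.trans ((hε.exact_zero _).2 ⟨b, hb, rfl⟩))
    refine ⟨C.d b, v, by simp, ?_, hv.symm⟩
    exact eq_zero_of_mem_lowerF (by simp) (h.apply_mem_lowerF le_rfl (mem_lowerF (by omega) hdb))
  · obtain ⟨j, hj⟩ : ∃ j : ℕ, n = j + 2 := ⟨(n - 2).toNat, by omega⟩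
    have h1 := h.anchor _ (by omega) _ hdb
    rw [d_d, sub_zero] at h1
    have hdb' : C.d b ∈ C.lowerF n := mem_lowerF (by omega) hdb
    -- The pair (E (d b), f (d b)) is a cone cycle of filtration n - 2, since d² = 0. Hence it
    -- bounds some (z, w) with z in filtration n - 1, and d b - z is the required correction of d b.
    obtain ⟨z, hz, w, hEz, hfz⟩ := h.exists_cone_boundary hε hκ j (by omega) (y := E (C.d b))
      (v := f (C.d b)) (lowerF_mono (by omega) h1) (h.sq_of_mem_lowerF hdb')
      (h.comm_of_mem_lowerF hdb')
    refine ⟨C.d b - z, -w, ?_, ?_, ?_⟩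
    · rw [sub_sub_cancel_left]
      exact neg_mem (lowerF_mono (by omega) hz)
    · rw [map_sub, hEz, sub_self]
    · rw [map_sub, ← hfz, sub_sub_cancel_left, map_neg]

end IsPartialFlag

/-- The differential is homogeneous, so the components of a cycle are cycles. Since κ preserves
degrees, only the component of degree k contributes to a value of degree k. -/
theorem exists_homogeneous_cycle [DirectSum.Decomposition gD] [DirectSum.Decomposition gM] {a : ℤ}
    (hdD : ∀ k, ∀ x ∈ gD k, dD x ∈ gD (k + a)) {κ : LinearMap.ker dD →ₗ[S] M}
    (hκ : ∀ k, ∀ v : LinearMap.ker dD, v.1 ∈ gD k → κ v ∈ gM k) (v : LinearMap.ker dD) {k : ℤ}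
    (hv : κ v ∈ gM k) : ∃ w : LinearMap.ker dD, w.1 ∈ gD k ∧ κ w = κ v := by
  classical
  have hker : ∀ j, homPart gD j v.1 ∈ LinearMap.ker dD := fun j => by
    have := homPart_map gD gD dD.toAddMonoidHom a hdD j v.1
    rw [LinearMap.mem_ker]
    change _ = dD _ at this
    rw [← this]
    change homPart gD _ (dD v.1) = 0
    rw [LinearMap.mem_ker.1 v.2, map_zero]
  have hsum : v = ∑ j ∈ (DirectSum.decompose gD v.1).support, ⟨homPart gD j v.1, hker j⟩ := by
    refine Subtype.ext ?_
    rw [AddSubmonoidClass.coe_finsetSum]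
    exact (DirectSum.sum_support_decompose gD v.1).symm
  refine ⟨⟨homPart gD k v.1, hker k⟩, homPart_mem _ _ _, ?_⟩
  rw [← homPart_of_mem gM hv]
  conv_rhs => rw [hsum, map_sum, map_sum]
  have hne : ∀ j, j ≠ k → homPart gM k (κ ⟨homPart gD j v.1, hker j⟩) = 0 := fun j hj =>
    homPart_of_mem_ne gM (hκ j _ (homPart_mem _ _ _)) hj
  have heq := homPart_of_mem gM (hκ k ⟨_, hker k⟩ (homPart_mem gD k v.1))
  rw [Finset.sum_eq_single k (fun j _ hj => hne j hj), heq]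
  intro hk
  rw [heq]
  have : (⟨homPart gD k v.1, hker k⟩ : LinearMap.ker dD) = 0 := by
    refine Subtype.ext ?_
    rw [DFinsupp.notMem_support_iff] at hk
    change homPart gD k v.1 = 0
    exact congrArg (fun z : gD k => (z : D)) hk
  rw [this, map_zero]

/-- On a basis vector b of F n the new values are E b = y and f b = v, for a cone cycle (y, v) with
leading term d b; all conditions survive passing to homogeneous components. For n = 0, E b = 0 and f
b is a homogeneous cycle representing the augmentation of b. -/
theorem IsPartialFlag.exists_succ [GradedRing 𝒜] [DirectSum.Decomposition gD]
    [DirectSum.Decomposition gM] [SetLike.GradedSMul 𝒜 gD] {κ : LinearMap.ker dD →ₗ[S] M}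
    {a n : ℤ} {E : Module.End S T} {f : T →ₗ[S] D}
    (h : C.IsPartialFlag ε gD dD κ a n E f) (hn : 0 ≤ n) (hε : C.IsResolution gM ε)
    (hdD : ∀ k, ∀ x ∈ gD k, dD x ∈ gD (k + a))
    (hκ0 : ∀ v, κ v = 0 ↔ ∃ u, dD u = v.1) (hκs : Function.Surjective κ)
    (hκ : ∀ k, ∀ v : LinearMap.ker dD, v.1 ∈ gD k → κ v ∈ gM k) :
    ∃ E' f', C.IsPartialFlag ε gD dD κ a (n + 1) E' f' := by
  obtain ⟨ι, ⟨B⟩⟩ := C.exists_adaptedBasis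
  have hex : ∀ i, ∃ y v, B.h i = n → (y - C.d (B.b i) ∈ C.lowerF (n - 1) ∧ E y = 0 ∧
      f y = dD v ∧ y ∈ foldGr C.gr a (B.e i - B.h i * a + a) ∧ v ∈ gD (B.e i - B.h i * a) ∧
      (n = 0 → ∃ hv : v ∈ LinearMap.ker dD, κ ⟨v, hv⟩ = B.augmentation ε (B.b i))) := by
    intro i
    by_cases hi : B.h i = n
    · have hb : B.b i ∈ C.F n := hi ▸ B.basis_mem_F i
      have hgr := B.basis_mem_gr i
      rcases hn.eq_or_lt with rfl | hn
      · obtain ⟨v, hv⟩ := hκs (ε ⟨B.b i, hb⟩)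
        rw [hi] at hgr
        obtain ⟨w, hw, hwv⟩ := exists_homogeneous_cycle (gM := gM) hdD hκ v (k := B.e i) (by
          rw [hv]
          exact hε.graded _ _ hgr)
        have hdb : C.d (B.b i) = 0 := eq_zero_of_mem_F_neg (by omega) (C.d_mem _ _ hb)
        refine ⟨0, w.1, fun _ => ⟨by simp [hdb], map_zero _, ?_, zero_mem _, ?_, fun _ =>
          ⟨w.2, ?_⟩⟩⟩
        · rw [map_zero, LinearMap.mem_ker.1 w.2]
        · simpa [hi] using hw
        · rw [B.augmentation_of_mem hb, ← hv, ← hwv]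
      · obtain ⟨y, v, hy, hEy, hfy⟩ := h.exists_cone_cycle hε hκ0 hn hb
        refine ⟨homPart (foldGr C.gr a) (B.e i - B.h i * a + a) y,
          homPart gD (B.e i - B.h i * a) v, fun _ => ⟨?_, ?_, ?_, homPart_mem _ _ _,
            homPart_mem _ _ _, fun h => absurd h hn.ne'⟩⟩
        · have hdb : C.d (B.b i) ∈ foldGr C.gr a (B.e i - B.h i * a + a) := by
            convert ((B.mem_gr_iff a _ _ _).1 (C.d_gr _ _ _ hgr)).2 using 2
            ring
          rw [← homPart_of_mem _ hdb, ← map_sub]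
          exact homPart_mem_lowerF _ _ _ hy
        · have := homPart_map _ _ E.toAddMonoidHom a h.homog (B.e i - B.h i * a + a) y
          exact this.symm.trans ((congrArg _ hEy).trans (map_zero _))
        · have h1 := homPart_map' (foldGr C.gr a) gD f.toAddMonoidHom (e := 0)
            (fun k x hx => by rw [add_zero]; exact h.map_homog k x hx) (add_zero _).symm y
            (k := B.e i - B.h i * a + a)
          have h2 := homPart_map gD gD dD.toAddMonoidHom a hdD (B.e i - B.h i * a) v
          exact h1.symm.trans ((congrArg _ hfy).trans h2)
    · exact ⟨0, 0, fun h => absurd h hi⟩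
  choose y v hyv using hex
  have hylow : ∀ i, B.h i = n → y i ∈ C.lowerF n := fun i hi => by
    have := add_mem (lowerF_mono (by omega) (hyv i hi).1)
      (mem_lowerF (n := n) (by omega) (C.d_mem _ _ (B.basis_mem_F i)))
    rwa [sub_add_cancel] at this
  -- Values of E on lower components stay in lower components, so the change in degree n leaves the
  -- old conditions intact.
  have hElow : ∀ m < n, ∀ x ∈ C.F m, E x ∈ C.lowerF n := fun m hm x hx =>
    lowerF_mono (by omega) (h.apply_mem_lowerF le_rfl (mem_lowerF hm hx))
  refine ⟨B.update n E y, B.update n f v, fun m hm x hx => ?_, fun m hm x hx => ?_,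
    fun m hm x hx => ?_, fun _ x => ?_, fun k x hx => ?_, fun k x hx => ?_⟩
  · by_cases hmn : m = n
    · subst hmn
      induction x, hx using B.induction_F with
      | zero => simp
      | add x y _ _ hx hy =>
        rw [map_add, map_add, add_sub_add_comm]
        exact add_mem hx hy
      | smul c x _ hx =>
        rw [map_smul, map_smul, ← smul_sub]
        exact Submodule.smul_mem _ _ hx
      | basis i _ hi =>
        rw [B.update_basis _ _ hi]
        exact (hyv i hi).1
    · rw [B.update_of_ne _ _ hmn hx]
      exact h.anchor m (by omega) x hx
  · by_cases hmn : m = n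
    · subst hmn
      induction x, hx using B.induction_F with
      | zero => simp
      | add x y _ _ hx hy => rw [map_add, map_add, hx, hy, add_zero]
      | smul c x _ hx => rw [map_smul, map_smul, hx, smul_zero]
      | basis i _ hi =>
        rw [B.update_basis _ _ hi, B.update_of_mem_lowerF _ _ (hylow i hi)]
        exact (hyv i hi).2.1
    · rw [B.update_of_ne _ _ hmn hx, B.update_of_mem_lowerF _ _ (hElow m (by omega) x hx)]
      exact h.sq m (by omega) x hx
  · by_cases hmn : m = n
    · subst hmn
      induction x, hx using B.induction_F with
      | zero => simp
      | add x y _ _ hx hy => simp only [map_add, hx, hy]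
      | smul c x _ hx => simp only [map_smul, hx]
      | basis i _ hi =>
        rw [B.update_basis _ _ hi, B.update_of_mem_lowerF _ _ (hylow i hi), B.update_basis _ _ hi]
        exact (hyv i hi).2.2.1
    · rw [B.update_of_ne _ _ hmn hx, B.update_of_mem_lowerF _ _ (hElow m (by omega) x hx),
        B.update_of_ne _ _ hmn hx]
      exact h.comm m (by omega) x hx
  · rw [← B.augmentation_of_mem x.2]
    rcases hn.eq_or_lt with rfl | hn
    · obtain ⟨x, hx⟩ := x
      induction x, hx using B.induction_F with
      | zero =>
        refine ⟨by simp, Eq.trans ?_ (map_zero (B.augmentation ε)).symm⟩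
        exact (congrArg κ (Subtype.ext (map_zero _))).trans (map_zero κ)
      | add x y _ _ hx hy =>
        obtain ⟨hx, hx'⟩ := hx
        obtain ⟨hy, hy'⟩ := hy
        refine ⟨by rw [map_add]; exact add_mem hx hy, ?_⟩
        rw [map_add (B.augmentation ε), ← hx', ← hy', ← map_add κ]
        exact congrArg κ (Subtype.ext (map_add _ _ _))
      | smul c x _ hx =>
        obtain ⟨hx, hx'⟩ := hx
        refine ⟨by rw [map_smul]; exact Submodule.smul_mem _ c hx, ?_⟩
        rw [map_smul (B.augmentation ε), ← hx', ← map_smul κ]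
        exact congrArg κ (Subtype.ext (map_smul _ _ _))
      | basis i _ hi =>
        simp only [B.update_basis _ _ hi]
        exact (hyv i hi).2.2.2.2.2 rfl
    · simp only [B.update_of_ne _ _ hn.ne x.2, B.augmentation_of_mem x.2]
      exact h.aug hn x
  · refine B.mem_of_basis_mem a a (fun j k c hc v hv => B.smul_mem_foldGr a hc hv) (fun i => ?_) hx
    by_cases hi : B.h i = n
    · rw [B.update_basis _ _ hi]
      exact (hyv i hi).2.2.2.1
    · rw [B.update_of_ne _ _ hi (B.basis_mem_F i)]
      exact h.homog _ _ (B.basis_mem_foldGr a i)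
  · rw [← add_zero k]
    refine B.mem_of_basis_mem a 0 (fun j k c hc v hv => ?_) (fun i => ?_) hx
    · rw [add_comm]
      exact SetLike.GradedSMul.smul_mem hc hv
    · rw [add_zero]
      by_cases hi : B.h i = n
      · rw [B.update_basis _ _ hi]
        exact (hyv i hi).2.2.2.2.1
      · rw [B.update_of_ne _ _ hi (B.basis_mem_F i)]
        exact h.map_homog _ _ (B.basis_mem_foldGr a i)

theorem exists_isPartialFlag [GradedRing 𝒜] [DirectSum.Decomposition gD]
    [DirectSum.Decomposition gM] [SetLike.GradedSMul 𝒜 gD] {κ : LinearMap.ker dD →ₗ[S] M}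
    {a : ℤ} (hε : C.IsResolution gM ε) (hdD : ∀ k, ∀ x ∈ gD k, dD x ∈ gD (k + a))
    (hκ0 : ∀ v, κ v = 0 ↔ ∃ u, dD u = v.1) (hκs : Function.Surjective κ)
    (hκ : ∀ k, ∀ v : LinearMap.ker dD, v.1 ∈ gD k → κ v ∈ gM k) (n : ℕ) :
    ∃ E f, C.IsPartialFlag ε gD dD κ a n E f := by
  induction n with
  | zero =>
    have h0 : ∀ m : ℤ, m < (0 : ℕ) → ∀ x ∈ C.F m, x = 0 := fun m hm x hx =>
      eq_zero_of_mem_F_neg (by simpa using hm) hx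
    refine ⟨0, 0, fun m hm x hx => ?_, fun m hm x hx => rfl, fun m hm x hx => ?_,
      fun h => absurd h (by simp), fun k x hx => zero_mem _, fun k x hx => zero_mem _⟩
    · simp [h0 m hm x hx]
    · simp
  | succ n ih =>
    obtain ⟨E, f, h⟩ := ih
    exact_mod_cast h.exists_succ (by positivity) hε hdD hκ0 hκs hκ

theorem IsPartialFlag.isAnchoredFlag {κ : LinearMap.ker dD →ₗ[S] M} {a n : ℤ}
    {E : Module.End S T} {f : T →ₗ[S] D} (h : C.IsPartialFlag ε gD dD κ a n E f)
    (hn : C.len < n) : C.IsAnchoredFlag a E := by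
  obtain ⟨ι, ⟨B⟩⟩ := C.exists_adaptedBasis
  have hanchor : ∀ m, ∀ x ∈ C.F m, E x - C.d x ∈ C.lowerF (m - 1) := by
    intro m x hx
    by_cases hm : m < n
    · exact h.anchor m hm x hx
    · rw [C.bounded m (Or.inr (by omega)), Submodule.mem_bot] at hx
      simp [hx]
  refine ⟨B.ext_F fun m _ hm x hx => h.sq m (by omega) x hx, h.homog, fun m x hx => ?_, hanchor⟩
  rw [← sub_add_cancel (E x) (C.d x)]
  exact add_mem (lowerF_mono (by omega) (hanchor m x hx))
    (mem_lowerF (n := m) (by omega) (C.d_mem m x hx))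

/-- Both halves are acyclicity of the mapping cone: injectivity for cycles (y, v) with f y = dD v,
surjectivity for cycles (0, v). -/
theorem IsPartialFlag.bijective_homologyMap {κ : LinearMap.ker dD →ₗ[S] M} {a n : ℤ}
    {E : Module.End S T} {f : T →ₗ[S] D} (h : C.IsPartialFlag ε gD dD κ a n E f)
    (hn : C.len + 1 < n) (hε : C.IsResolution gM ε) (hκ0 : ∀ v, κ v = 0 ↔ ∃ u, dD u = v.1)
    (hf : f ∘ₗ E = dD ∘ₗ f) : Function.Bijective (DiffMod.homologyMap E dD f hf) := by
  obtain ⟨ι, ⟨B⟩⟩ := C.exists_adaptedBasis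
  constructor
  · rw [injective_iff_map_eq_zero]
    intro c hc
    obtain ⟨⟨y, hy⟩, rfl⟩ := Submodule.Quotient.mk_surjective _ c
    obtain ⟨v, hv⟩ := (Submodule.Quotient.mk_eq_zero _).1 hc
    obtain ⟨z, -, w, hz, -⟩ := h.exists_cone_boundary hε hκ0 (C.len + 1) (by push_cast; omega)
      (y := y) (v := v) (by rw [B.lowerF_eq_top (by push_cast; omega)]; trivial) hy hv.symm
    exact (Submodule.Quotient.mk_eq_zero _).2 ⟨z, hz⟩
  · intro c
    obtain ⟨⟨v, hv⟩, rfl⟩ := Submodule.Quotient.mk_surjective _ c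
    obtain ⟨z, -, w, hz, hw⟩ := h.exists_cone_boundary hε hκ0 0 (by push_cast; omega)
      (y := 0) (v := v) (zero_mem _) (map_zero _)
      (by rw [map_zero, LinearMap.mem_ker.1 hv])
    refine ⟨Submodule.Quotient.mk ⟨z, hz⟩, (Submodule.Quotient.eq _).2 ⟨w, ?_⟩⟩
    rw [sub_eq_iff_eq_add] at hw
    change dD w = f z - v
    rw [hw, add_sub_cancel_left]

end DifferentialModule

/-- Every differential module with homology `M` receives a quasi-isomorphism from a free flag
anchored on a resolution of `M`. -/
theorem IsResolution.exists_flag_quasiIso [GradedRing 𝒜] {M : Type u} [AddCommGroup M] [Module S M]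
    {gM : ℤ → AddSubgroup M} [DirectSum.Decomposition gM] {ε : C.F 0 →ₗ[S] M}
    (hε : C.IsResolution gM ε) (a : ℤ) {D : Type u} [AddCommGroup D] [Module S D]
    (gD : ℤ → AddSubgroup D) [DirectSum.Decomposition gD] [SetLike.GradedSMul 𝒜 gD]
    {dD : Module.End S D} (hdD : ∀ k, ∀ x ∈ gD k, dD x ∈ gD (k + a))
    (e : DiffMod.Homology dD ≃ₗ[S] M)
    (he : ∀ k, ∀ x : LinearMap.ker dD, (x : D) ∈ gD k → e (Submodule.Quotient.mk x) ∈ gM k) :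
    ∃ (E : Module.End S T) (f : T →ₗ[S] D) (hf : f ∘ₗ E = dD ∘ₗ f), C.IsAnchoredFlag a E ∧
      (∀ k, ∀ x ∈ foldGr C.gr a k, f x ∈ gD k) ∧
      Function.Bijective (DiffMod.homologyMap E dD f hf) := by
  have hκ0 : ∀ v, (e.toLinearMap ∘ₗ Submodule.mkQ _) v = 0 ↔ ∃ u, dD u = v.1 := fun v =>
    (LinearEquiv.map_eq_zero_iff e).trans (Submodule.Quotient.mk_eq_zero _)
  -- Stage `len + 1` already determines E and f on all of T; one further stage brings the filtration
  -- step `len + 1`, which is T, into the acyclic range.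
  obtain ⟨E, f, h⟩ := exists_isPartialFlag hε hdD hκ0
    (e.surjective.comp (Submodule.mkQ_surjective _)) he (C.len + 2)
  obtain ⟨ι, ⟨B⟩⟩ := C.exists_adaptedBasis
  have hf : f ∘ₗ E = dD ∘ₗ f :=
    B.ext_F fun m _ hm x hx => h.comm m (by push_cast; omega) x hx
  exact ⟨E, f, hf, h.isAnchoredFlag (by push_cast; omega), h.map_homog,
    h.bijective_homologyMap (by push_cast; omega) hε hκ0 hf⟩

end GradedFreeComplex

end

/-! ### Assembly of the theorem -/

theorem theorem1 {S : Type u} [CommRing S] (𝒜 : ℤ → AddSubgroup S) [GradedRing 𝒜]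
    {T : Type u} [AddCommGroup T] [Module S T] (C : GradedFreeComplex 𝒜 T) (a : ℤ) :
    -- the free flags anchored on the complex are the results of iterated deformations
    (∀ D : Module.End S T, C.IsAnchoredFlag a D ↔ ∃ δ, C.IsIteratedDeformation a δ D) ∧
    -- the obstruction to lifting from `S[t] / (t ^ i)` to `S[t] / (t ^ (i + 1))`
    (∀ i : ℕ, 1 ≤ i → ∀ δ : ℕ → Module.End S T, C.IsDeformation a i δ →
      ∃ hz : C.obstruction i δ ∈ EndComplex.cocycles C.F C.d (i + 2),
        EndComplex.cls C.F C.d (i + 2) ⟨C.obstruction i δ, hz⟩ ∈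
          EndComplex.HDeg C.F C.gr C.d (i + 2) (2 * a - (i + 2) * a) ∧
        ((∃ y, C.IsLift a i δ y) ↔
          EndComplex.cls C.F C.d (i + 2) ⟨C.obstruction i δ, hz⟩ = 0)) ∧
    -- the parametrization of the lifts, relative to one of them
    (∀ i : ℕ, 1 ≤ i → ∀ δ : ℕ → Module.End S T, C.IsDeformation a i δ →
      ∀ x : Module.End S T, C.IsLift a i δ x →
      ∃ Φ : {y : Module.End S T // C.IsLift a i δ y} →
          EndComplex.HDeg C.F C.gr C.d (i + 1) (a - (i + 1) * a),
        (∀ y, ∃ hz : (y.1 - x) * C.parity ^ i ∈ EndComplex.cocycles C.F C.d (i + 1),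
          (Φ y : EndComplex.H C.F C.d (i + 1)) =
            EndComplex.cls C.F C.d (i + 1) ⟨(y.1 - x) * C.parity ^ i, hz⟩) ∧
        Function.Surjective Φ ∧
        ∀ y y', Φ y = Φ y' ↔ C.LiftIso a i δ y.1 y'.1) ∧
    -- comparison with the cohomology of the endomorphism complex over `S[t] / (t ^ (i + 1))`
    (∀ i : ℕ, 1 ≤ i →
      ∃ Ψ : EndComplex.H C.F C.d (i + 1) →ₗ[S]
          EndComplex.H (C.truncF (i + 1)) (C.truncD (i + 1)) (i + 1),
        (∀ z : EndComplex.cocycles C.F C.d (i + 1),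
          ∃ hz : z.1.baseChange (TruncPoly S (i + 1)) ∈
              EndComplex.cocycles (C.truncF (i + 1)) (C.truncD (i + 1)) (i + 1),
            Ψ (EndComplex.cls C.F C.d (i + 1) z) = TruncPoly.t S (i + 1) ^ i •
              EndComplex.cls (C.truncF (i + 1)) (C.truncD (i + 1)) (i + 1) ⟨_, hz⟩) ∧
        Function.Injective Ψ ∧
        ∀ e : ℤ, (EndComplex.HDeg C.F C.gr C.d (i + 1) e).map Ψ.toAddMonoidHom =
          (Ideal.span {TruncPoly.t S (i + 1) ^ i} •
            (⊤ : Submodule (TruncPoly S (i + 1))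
              (EndComplex.H (C.truncF (i + 1)) (C.truncD (i + 1)) (i + 1)))).toAddSubgroup ⊓
          EndComplex.HDeg (C.truncF (i + 1)) (C.truncGr (i + 1)) (C.truncD (i + 1)) (i + 1) e) ∧
    -- the case of a resolution
    (∀ (M : Type u) [AddCommGroup M] [Module S M] (gM : ℤ → AddSubgroup M)
      [DirectSum.Decomposition gM] [SetLike.GradedSMul 𝒜 gM] (ε : C.F 0 →ₗ[S] M),
      C.IsResolution gM ε →
      (∀ p : ℕ, Nonempty (EndComplex.H C.F C.d p ≃ₗ[S]
        CategoryTheory.Abelian.Ext (ModuleCat.of S M) (ModuleCat.of S M) p)) ∧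
      ∀ (D : Type u) [AddCommGroup D] [Module S D] (gD : ℤ → AddSubgroup D)
        [DirectSum.Decomposition gD] [SetLike.GradedSMul 𝒜 gD] (dD : Module.End S D),
        dD * dD = 0 → (∀ k, ∀ x ∈ gD k, dD x ∈ gD (k + a)) →
        ∀ e : DiffMod.Homology dD ≃ₗ[S] M,
        (∀ k, ∀ x : LinearMap.ker dD, (x : D) ∈ gD k → e (Submodule.Quotient.mk x) ∈ gM k) →
        ∃ (δ : ℕ → Module.End S T) (E : Module.End S T) (f : T →ₗ[S] D)
          (hf : f ∘ₗ E = dD ∘ₗ f),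
          C.IsIteratedDeformation a δ E ∧
          (∀ k, ∀ x ∈ foldGr C.gr a k, f x ∈ gD k) ∧
          Function.Bijective (DiffMod.homologyMap E dD f hf)) := by
  refine ⟨fun D => C.isAnchoredFlag_iff a D, fun i hi δ h => ⟨h.obstruction_mem_cocycles hi,
    ⟨_, h.isHomog_obstruction, rfl⟩, h.exists_isLift_iff hi⟩,
    fun i hi δ h x hx => GradedFreeComplex.exists_lift_parametrization hi h hx,
    fun i _ => ⟨C.cohomologyToTrunc (i + 1) i (i + 1),
      fun z => ⟨C.baseChange_mem_cocycles (i + 1) z.2, C.cohomologyToTrunc_cls _ _ _ z⟩,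
      C.cohomologyToTrunc_injective (by omega) _,
      fun e => C.map_HDeg_cohomologyToTrunc i _ e⟩,
    fun M _ _ gM _ _ ε hε => ⟨hε.nonempty_linearEquiv_ext, fun D _ _ gD _ _ dD _ hdD e he => ?_⟩⟩
  obtain ⟨E, f, hf, hE, hfg, hbij⟩ := hε.exists_flag_quasiIso a gD hdD e he
  obtain ⟨δ, hδ⟩ := (C.isAnchoredFlag_iff a E).1 hE
  exact ⟨δ, E, f, hf, hδ, hfg, hbij⟩
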